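/- A cubic partition of a nonnegative integer $m$ is a partition of $m$ in which each even part is coloured blue or red (odd parts have only one colour). An overcubic partition of $m$ is a cubic partition of $m$ in which, for each distinct coloured part, its first occurrence may be overlined. Let $\overline{bt}(n)$ denote the number of overcubic partition triples of $n$, that is, of ordered triples $(\pi_1,\pi_2,\pi_3)$ of overcubic partitions (each possibly empty) whose parts, taken together, sum to $n$. Then for all integers $n,\alpha\ge 0$, \begin{align*} \overline{bt}(144n+42)&\equiv 0 \pmod{384},\\ \overline{bt}\bigl(2^{\alpha}(72n+21)\bigr)&\equiv 0 \pmod{128},\\ \overline{bt}\bigl(2^{\alpha}(72n+69)\bigr)&\equiv 0 \pmod{128}. \end{align*} -/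

import Mathlib

/-- An overcubic partition: a partition whose even parts come in two colours and in which the
first occurrence of each coloured part may be overlined.

A coloured part is a pair `(m, c)`, where `m` is its size and `c = true` means red. An odd part has
no choice of colour and is always written `(m, false)`; an even part is `(m, false)` (blue) or
`(m, true)` (red). A partition, as a weakly decreasing sequence, is the multiset `parts` of its
parts, and `overlined` is the set of the distinct coloured parts whose first occurrence is
overlined. -/
@[ext]
structure OvercubicPartition where
  /-- the multiset of coloured parts -/
  parts : Multiset (ℕ × Bool)
  /-- the coloured parts whose first occurrence is overlined -/
  overlined : Finset (ℕ × Bool)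
  pos_of_mem : ∀ p ∈ parts, 0 < p.1
  even_of_red : ∀ p ∈ parts, p.2 = true → Even p.1
  mem_of_overlined : ∀ p ∈ overlined, p ∈ parts

namespace OvercubicPartition

/-- The number that is partitioned: the sum of the sizes of all parts. -/
def size (π : OvercubicPartition) : ℕ := (π.parts.map Prod.fst).sum

/-- Only finitely many overcubic partitions have size at most `n`. -/
theorem finite_size_le (n : ℕ) : {π : OvercubicPartition | π.size ≤ n}.Finite := by
  classical
  set S : Finset (ℕ × Bool) := Finset.range (n + 1) ×ˢ Finset.univ with hS
  have key : ∀ π : OvercubicPartition, π.size ≤ n → ∀ p ∈ π.parts, p ∈ S := by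
    intro π hπ p hp
    have h : p.1 ≤ π.size := Multiset.le_sum_of_mem (Multiset.mem_map_of_mem Prod.fst hp)
    simp [hS]
    omega
  have hfin : ((Set.Iic (n • S.val)) ×ˢ ((S.powerset : Finset (Finset (ℕ × Bool))) :
      Set (Finset (ℕ × Bool)))).Finite := (Set.finite_Iic _).prod (Finset.finite_toSet _)
  refine Set.Finite.of_injOn (f := fun π => (π.parts, π.overlined)) ?_ ?_ hfin
  · intro π hπ
    have hk := key π hπ
    refine ⟨?_, ?_⟩
    · refine Multiset.le_iff_count.2 fun p => ?_
      by_cases hp : p ∈ π.parts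
      · have h1 : Multiset.count p S.val = 1 :=
          Multiset.count_eq_one_of_mem S.nodup (hk p hp)
        have h2 : π.parts.card ≤ π.size := by
          have := Multiset.card_nsmul_le_sum (s := π.parts.map Prod.fst) (a := 1) (by
            intro x hx
            obtain ⟨q, hq, rfl⟩ := Multiset.mem_map.1 hx
            exact π.pos_of_mem q hq)
          simpa [size] using this
        have h3 := Multiset.count_le_card p π.parts
        have h4 : π.size ≤ n := hπ
        simp only [Multiset.count_nsmul, h1]
        omega
      · simp [Multiset.count_eq_zero_of_notMem hp]
    · simp only [Finset.coe_powerset, Set.mem_preimage, Set.mem_powerset_iff]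
      intro p hp
      exact hk p (π.mem_of_overlined p hp)
  · intro π _ ρ _ h
    simp only [Prod.mk.injEq] at h
    exact OvercubicPartition.ext h.1 h.2

end OvercubicPartition

/-- The overcubic partition triples of `n`: ordered triples of overcubic partitions whose sizes
add up to `n`. -/
def overcubicTriples (n : ℕ) : Set (OvercubicPartition × OvercubicPartition × OvercubicPartition) :=
  {t | t.1.size + t.2.1.size + t.2.2.size = n}

theorem overcubicTriples_finite (n : ℕ) : (overcubicTriples n).Finite := by
  have h := OvercubicPartition.finite_size_le n
  refine (h.prod (h.prod h)).subset ?_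
  rintro ⟨a, b, c⟩ ht
  simp only [overcubicTriples, Set.mem_ofPred_eq] at ht
  simp only [Set.mem_prod, Set.mem_ofPred_eq]
  omega

/-- The number of overcubic partition triples of `n`. -/
noncomputable def overlineBt (n : ℕ) : ℕ := (overcubicTriples n).ncard

/-! Let φ(q) be the theta series of all integer squares and V(q) the sum of q^(x²) over odd x > 0.
By Gauss' product for φ(-q), overcubic partitions have generating series 1 / (φ(-q) φ(-q²))
(`overcubicSeries_mul`), and triples have its cube.

Modulo 128, every series 1 + 2e has 64th power 1. With φ(q) φ(-q) = φ(-q²)² the cube becomes φ(q)³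
φ(-q²)^55 (`overcubicMod_pow_three`). The dissections φ(q) = φ(q⁴) + 2V(q), φ(q²)² = φ(q⁴)² + 4V(q)²
and V(q)² = φ(q⁸) V(q²) bring its odd part to the form V(q) S + V(q) V(q²) T + 32z V(q)³ V(q²),
where S is a series in q⁸ and T one in q⁴. The first two terms have exponents 1 mod 8 and 3 mod 4,
so an exponent 5 mod 8 sees only the third. If 3 divides that exponent exactly once, the coefficient
of V(q)³ V(q²) is a multiple of 4 (`four_dvd_coeff`, a dissection modulo 3), and 32 · 4 = 128.

For the factor 2^α, even exponents are extracted repeatedly. From the second extraction on, the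
series stays in the family φ(q²) φ(q)^(8j+1) φ(-q²)^(8c) (`exists_coeff_eq`), whose odd part has the
same kind of decomposition (`coeff_odd_mul_eq_zero`).

The factor 3 of 384 comes from cubing being q ↦ q³ modulo 3, together with φ(q) having no exponent 2
mod 3 (`three_dvd_overlineBt`). -/

open PowerSeries Finset

/-! ### Counting overcubic partitions and triples by power series -/

/-- The series `1 + 2 ∑ X ^ (p m)`, which records the copies of a part of size `p`. -/
noncomputable def partFactor (p : ℕ) : ℤ⟦X⟧ :=
  PowerSeries.mk fun k => if k = 0 then 1 else if p ∣ k then 2 else 0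

theorem partFactor_mul (p : ℕ) (hp : 0 < p) :
    partFactor p * (1 - X ^ p) = 1 + X ^ p := by
  ext n
  rw [mul_sub, mul_one, map_sub, map_add, coeff_mul_X_pow', coeff_one, coeff_X_pow, partFactor,
    coeff_mk, coeff_mk]
  rcases lt_trichotomy n p with h | h | h
  · have h1 : ¬ p ≤ n := by omega
    by_cases h0 : n = 0
    · simp [h0, hp.ne, hp.ne']
    · have h2 : ¬ p ∣ n := fun hd => h1 (Nat.le_of_dvd (by omega) hd)
      simp [h0, h1, h2, h.ne]
  · subst h
    simp [hp.ne']
  · have h0 : n ≠ 0 := by omega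
    have h1 : n - p ≠ 0 := by omega
    have h2 : p ∣ n - p ↔ p ∣ n := by
      rw [← Nat.dvd_add_left (dvd_refl p), Nat.sub_add_cancel h.le]
    simp [h0, h1, h2, h.le, h.ne']

namespace OvercubicPartition

theorem size_eq_sum_count (π : OvercubicPartition) (S : Finset (ℕ × Bool))
    (hS : ∀ p ∈ π.parts, p ∈ S) : π.size = ∑ p ∈ S, p.1 * π.parts.count p := by
  classical
  rw [size, Finset.sum_multiset_map_count]
  have : π.parts.toFinset ⊆ S := fun p hp => hS p (Multiset.mem_toFinset.1 hp)
  rw [Finset.sum_subset this]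
  · simp [mul_comm]
  · intro p _ hp
    simp [Multiset.count_eq_zero_of_notMem (fun h => hp (Multiset.mem_toFinset.2 h))]

theorem fst_le_size (π : OvercubicPartition) {p : ℕ × Bool} (hp : p ∈ π.parts) :
    p.1 ≤ π.size :=
  Multiset.le_sum_of_mem (Multiset.mem_map_of_mem Prod.fst hp)

/-- The overcubic partitions of `n` are counted by the product of the factors of all coloured parts
in `S`, provided that `S` contains every coloured part of size at most `n`. -/
theorem ncard_size_eq (n : ℕ) (S : Finset (ℕ × Bool))
    (hS : ∀ p ∈ S, 0 < p.1 ∧ (p.2 = true → Even p.1))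
    (hn : ∀ p : ℕ × Bool, 0 < p.1 → (p.2 = true → Even p.1) → p.1 ≤ n → p ∈ S) :
    (({π : OvercubicPartition | π.size = n}.ncard : ℕ) : ℤ)
      = coeff n (∏ p ∈ S, partFactor p.1) := by
  classical
  -- A partition is encoded by the total size `l p` contributed by each coloured part, hence the
  -- divisibility condition, together with a subset of the support of `l` for the overlines.
  set D : Finset (ℕ × Bool →₀ ℕ) := (finsuppAntidiag S n).filter (fun l => ∀ p ∈ S, p.1 ∣ l p)
    with hD
  set T : Finset (Σ _ : ℕ × Bool →₀ ℕ, Finset (ℕ × Bool)) :=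
    D.sigma (fun l => l.support.powerset) with hT
  have hmem : ∀ π : OvercubicPartition, π.size = n → ∀ p ∈ π.parts, p ∈ S := fun π hπ p hp =>
    hn p (π.pos_of_mem p hp) (π.even_of_red p hp) (hπ ▸ π.fst_le_size hp)
  have hcard : {π : OvercubicPartition | π.size = n}.ncard = T.card := by
    rw [← Set.ncard_coe_finset]
    refine Set.ncard_congr (fun π hπ => ⟨Finsupp.onFinset S
      (fun p => p.1 * π.parts.count p) ?_, π.overlined⟩) ?_ ?_ ?_
    · intro p hp
      apply hmem π hπ p
      by_contra h
      simp [Multiset.count_eq_zero_of_notMem h] at hp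
    · intro π hπ
      simp only [hT, hD, Finset.coe_sigma, Set.mem_sigma_iff, Finset.mem_coe, Finset.mem_filter,
        mem_finsuppAntidiag, Finsupp.onFinset_apply, Finset.mem_powerset]
      refine ⟨⟨⟨?_, Finsupp.support_onFinset_subset⟩, fun p _ => dvd_mul_right _ _⟩, ?_⟩
      · exact (π.size_eq_sum_count S (hmem π hπ)).symm.trans hπ
      · intro p hp
        have h1 := π.mem_of_overlined p hp
        have h2 := π.pos_of_mem p h1
        have h3 := Multiset.count_pos.2 h1
        simp only [Finsupp.mem_support_iff, Finsupp.onFinset_apply]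
        positivity
    · intro π ρ hπ hρ h
      simp only [Sigma.mk.injEq, heq_eq_eq] at h
      refine OvercubicPartition.ext (Multiset.ext.2 fun p => ?_) h.2
      have h1 := DFunLike.congr_fun h.1 p
      simp only [Finsupp.onFinset_apply] at h1
      by_cases hp : p ∈ S
      · exact Nat.eq_of_mul_eq_mul_left (hS p hp).1 h1
      · rw [Multiset.count_eq_zero_of_notMem fun h => hp (hmem π hπ p h),
          Multiset.count_eq_zero_of_notMem fun h => hp (hmem ρ hρ p h)]
    · rintro ⟨l, O⟩ hl
      simp only [hT, hD, Finset.coe_sigma, Set.mem_sigma_iff, Finset.mem_coe, Finset.mem_filter,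
        mem_finsuppAntidiag, Finset.mem_powerset] at hl
      obtain ⟨⟨⟨hsum, hsupp⟩, hdvd⟩, hO⟩ := hl
      set m : Multiset (ℕ × Bool) := ∑ p ∈ S, (l p / p.1) • ({p} : Multiset (ℕ × Bool)) with hm
      have hcount : ∀ p, m.count p = if p ∈ S then l p / p.1 else 0 := by
        intro p
        rw [hm, Multiset.count_sum']
        simp [Multiset.count_nsmul, Multiset.count_singleton]
      have hmS : ∀ p ∈ m, p ∈ S := by
        intro p hp
        by_contra h
        have := Multiset.count_pos.2 hp
        simp [hcount, h] at this
      have hmul : ∀ p, p.1 * m.count p = l p := by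
        intro p
        rw [hcount]
        split_ifs with h
        · exact Nat.mul_div_cancel' (hdvd p h)
        · rw [mul_zero]
          by_contra h'
          exact h (hsupp (Finsupp.mem_support_iff.2 (Ne.symm h')))
      let π : OvercubicPartition :=
        { parts := m
          overlined := O
          pos_of_mem := fun p hp => (hS p (hmS p hp)).1
          even_of_red := fun p hp => (hS p (hmS p hp)).2
          mem_of_overlined := by
            intro p hp
            have h := Finsupp.mem_support_iff.1 (hO hp)
            by_contra h'
            rw [← hmul, Multiset.count_eq_zero_of_notMem h'] at h
            simp at h }
      refine ⟨π, ?_, ?_⟩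
      · change π.size = n
        rw [π.size_eq_sum_count S hmS, ← hsum]
        exact Finset.sum_congr rfl fun p _ => hmul p
      · simp only [Sigma.mk.injEq, heq_eq_eq]
        exact ⟨Finsupp.ext fun p => hmul p, rfl⟩
  rw [hcard, hT, Finset.card_sigma, coeff_prod, hD, Finset.sum_filter, Nat.cast_sum]
  refine Finset.sum_congr rfl fun l hl => ?_
  simp only [mem_finsuppAntidiag] at hl
  simp only [partFactor, coeff_mk]
  split_ifs with h
  -- Each coloured part that occurs contributes a factor 2, so the product counts the subsets of the
  -- support.
  · rw [Finset.card_powerset, Finset.prod_congr rfl (g := fun p => if l p ≠ 0 then (2 : ℤ) else 1)]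
    · rw [Finset.prod_ite, Finset.prod_const, Finset.prod_const_one, mul_one]
      have : S.filter (fun p => l p ≠ 0) = l.support := by
        ext p
        simp only [Finset.mem_filter, Finsupp.mem_support_iff]
        exact ⟨fun h => h.2, fun h => ⟨hl.2 (Finsupp.mem_support_iff.2 h), h⟩⟩
      rw [this]
      push_cast
      rfl
    · intro p hp
      have := h p hp
      split_ifs <;> simp_all
  · push Not at h
    obtain ⟨p, hp, hpd⟩ := h
    rw [Finset.prod_eq_zero hp]
    · simp
    · have : l p ≠ 0 := fun h => hpd (h ▸ dvd_zero _)
      simp [this, hpd]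

end OvercubicPartition

/-- The generating series of the overcubic partitions. -/
noncomputable def overcubicSeries : ℤ⟦X⟧ :=
  PowerSeries.mk fun n => (({π : OvercubicPartition | π.size = n}.ncard : ℕ) : ℤ)

/-- The index k supplies the two coloured parts `(k, false)` and `(2 * k, true)`. Parts larger than
n may be included freely, since they do not affect the coefficient. -/
theorem overcubicSeries_coeff (n N : ℕ) (h : n ≤ N) :
    coeff n overcubicSeries =
      coeff n (∏ k ∈ Icc 1 N, (partFactor k * partFactor (2 * k))) := by
  classical
  rw [overcubicSeries, coeff_mk, OvercubicPartition.ncard_size_eq n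
    ((Icc 1 N).image (fun k => (k, false)) ∪ (Icc 1 N).image (fun k => (2 * k, true)))]
  · rw [Finset.prod_union, Finset.prod_image, Finset.prod_image, Finset.prod_mul_distrib]
    · intro a _ b _ hab
      simpa using hab
    · intro a _ b _ hab
      simpa using hab
    · rw [Finset.disjoint_left]
      intro p hp hq
      simp only [Finset.mem_image] at hp hq
      obtain ⟨a, _, rfl⟩ := hp
      obtain ⟨b, _, hb⟩ := hq
      simp at hb
  · intro p hp
    simp only [Finset.mem_union, Finset.mem_image, Finset.mem_Icc] at hp
    rcases hp with ⟨a, ha, rfl⟩ | ⟨a, ha, rfl⟩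
    · exact ⟨ha.1, by simp⟩
    · exact ⟨by dsimp only; omega, by simp⟩
  · rintro ⟨m, c⟩ h1 h2 h3
    simp only [Finset.mem_union, Finset.mem_image, Finset.mem_Icc, Prod.mk.injEq]
    simp only at h1 h2 h3
    cases c
    · exact Or.inl ⟨m, ⟨h1, by omega⟩, rfl, rfl⟩
    · obtain ⟨r, hr⟩ := h2 rfl
      exact Or.inr ⟨r, ⟨by omega, by omega⟩, by omega, rfl⟩

theorem overlineBt_eq_coeff (n : ℕ) : (overlineBt n : ℤ) = coeff n (overcubicSeries ^ 3) := by
  classical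
  have hfin : ∀ k, {π : OvercubicPartition | π.size = k}.Finite := fun k =>
    (OvercubicPartition.finite_size_le k).subset fun π h => le_of_eq h
  set c : ℕ → Finset OvercubicPartition := fun k => (hfin k).toFinset with hc
  have hmem : ∀ k π, π ∈ c k ↔ π.size = k := by
    intro k π
    simp [hc]
  have hcoeff : ∀ k, coeff k overcubicSeries = ((c k).card : ℤ) := by
    intro k
    rw [overcubicSeries, coeff_mk, Set.ncard_eq_toFinset_card _ (hfin k)]
  have hbt : overlineBt n = ∑ a ∈ antidiagonal n, ∑ b ∈ antidiagonal a.2,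
      ((c a.1) ×ˢ ((c b.1) ×ˢ (c b.2))).card := by
    have key : overcubicTriples n = (((antidiagonal n).biUnion fun a =>
        (antidiagonal a.2).biUnion fun b => (c a.1) ×ˢ ((c b.1) ×ˢ (c b.2)) :
        Finset (OvercubicPartition × OvercubicPartition × OvercubicPartition)) : Set _) := by
      ext ⟨x, y, z⟩
      simp only [overcubicTriples, Set.mem_ofPred_eq, Finset.mem_coe, Finset.mem_biUnion,
        HasAntidiagonal.mem_antidiagonal, Finset.mem_product, hmem, Prod.exists]
      constructor
      · intro h
        exact ⟨x.size, y.size + z.size, by omega, y.size, z.size, rfl, rfl, rfl, rfl⟩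
      · rintro ⟨i, j, h1, k, l, h2, h3, h4, h5⟩
        omega
    rw [overlineBt, key, Set.ncard_coe_finset, Finset.card_biUnion]
    · refine Finset.sum_congr rfl fun a _ => ?_
      rw [Finset.card_biUnion]
      intro b _ b' _ hbb
      rw [Function.onFun, Finset.disjoint_left]
      rintro ⟨x, y, z⟩ h h'
      simp only [Finset.mem_product, hmem] at h h'
      exact hbb (Prod.ext (by omega) (by omega))
    · intro a ha b hb hab
      rw [Function.onFun, Finset.disjoint_left]
      rintro ⟨x, y, z⟩ h h'
      simp only [Finset.mem_biUnion, HasAntidiagonal.mem_antidiagonal, Finset.mem_product,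
        hmem] at h h' ha hb
      obtain ⟨u, hu, hu'⟩ := h
      obtain ⟨v, hv, hv'⟩ := h'
      simp only [Finset.mem_coe, HasAntidiagonal.mem_antidiagonal] at ha hb
      exact hab (Prod.ext (by omega) (by omega))
  rw [hbt, pow_succ', pow_two, coeff_mul]
  push_cast
  refine Finset.sum_congr rfl fun a _ => ?_
  rw [coeff_mul, Finset.mul_sum]
  refine Finset.sum_congr rfl fun b _ => ?_
  rw [hcoeff, hcoeff, hcoeff, Finset.card_product, Finset.card_product]
  push_cast
  ring

/-! ### A finite form of Gauss' identity -/

/-- The terms of the finite form of Gauss' square identity. -/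
def gaussTerm {R : Type*} [CommRing R] (q : R) (n : ℕ) : ℕ → R
  | 0 => ∏ i ∈ Icc 1 n, (1 - q ^ i)
  | k + 1 => (-1) ^ (k + 1) * 2 * (∏ i ∈ Icc 1 k, (1 + q ^ i)) *
      (∏ i ∈ Icc (k + 2) n, (1 - q ^ i)) * q ^ ((k + 1) * (n + 1))

section Gauss

variable {R : Type*} [CommRing R]

theorem gaussTerm_succ (q : R) (n k : ℕ) (hk : k ≤ n) :
    gaussTerm q (n + 1) k = (1 - q ^ (n + 1)) * q ^ k * gaussTerm q n k := by
  cases k with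
  | zero =>
    simp only [gaussTerm]
    rw [Finset.prod_Icc_succ_top (by omega)]
    ring
  | succ k =>
    simp only [gaussTerm]
    rw [Finset.prod_Icc_succ_top (by omega)]
    ring

/-- The recursion of `gaussTerm` in its second index. -/
theorem gaussTerm_next (q : R) (n k : ℕ) (hk : k + 2 ≤ n) :
    gaussTerm q n (k + 2) * (1 - q ^ (k + 2)) =
      -gaussTerm q n (k + 1) * (1 + q ^ (k + 1)) * q ^ (n + 1) := by
  simp only [gaussTerm]
  rw [Finset.prod_Icc_succ_top (by omega : 1 ≤ k + 1)]
  have h : ∏ i ∈ Icc (k + 2) n, (1 - q ^ i) =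
      (1 - q ^ (k + 2)) * ∏ i ∈ Icc (k + 3) n, (1 - q ^ i) := by
    rw [← Finset.Ioc_insert_left hk, Finset.prod_insert (by simp)]
    congr 2
    ext i
    simp only [Finset.mem_Ioc, Finset.mem_Icc]
    omega
  rw [h]
  ring

theorem gaussTerm_one (q : R) (n : ℕ) (hn : 1 ≤ n) :
    gaussTerm q n 1 * (1 - q) = -gaussTerm q n 0 * 2 * q ^ (n + 1) := by
  simp only [gaussTerm]
  have h : ∏ i ∈ Icc 1 n, (1 - q ^ i) = (1 - q) * ∏ i ∈ Icc 2 n, (1 - q ^ i) := by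
    rw [← Finset.Ioc_insert_left hn, Finset.prod_insert (by simp)]
    simp only [pow_one]
    rfl
  rw [h]
  simp
  ring

/-- The differences telescope in k: this is what makes the induction on n in `sum_gaussTerm` work.
-/
theorem sum_gaussTerm_sub (q : R) (n j : ℕ) (hj : j ≤ n) :
    ∑ k ∈ range (j + 1), (gaussTerm q (n + 1) k - (1 + q ^ (n + 1)) * gaussTerm q n k) =
      -gaussTerm q n j * (1 + q ^ j) * q ^ (n + 1) := by
  induction j with
  | zero =>
    rw [Finset.sum_range_one, gaussTerm_succ q n 0 (by omega)]
    ring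
  | succ j ih =>
    rw [Finset.sum_range_succ, ih (by omega), gaussTerm_succ q n (j + 1) hj]
    cases j with
    | zero =>
      have := gaussTerm_one q n (by omega)
      simp only [zero_add, pow_zero, pow_one] at this ⊢
      linear_combination -this
    | succ j =>
      have := gaussTerm_next q n j hj
      linear_combination -this

/-- A finite form of Gauss' identity for `∑ (-1) ^ k q ^ (k ^ 2)`. -/
theorem sum_gaussTerm (q : R) (n : ℕ) :
    ∑ k ∈ range (n + 1), gaussTerm q n k =
      (1 + 2 * ∑ k ∈ Icc 1 n, (-1) ^ k * q ^ (k ^ 2)) * ∏ i ∈ Icc 1 n, (1 + q ^ i) := by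
  induction n with
  | zero => simp [gaussTerm]
  | succ n ih =>
    have h := sum_gaussTerm_sub q n n le_rfl
    rw [Finset.sum_sub_distrib, ← Finset.mul_sum, ih] at h
    rw [Finset.sum_range_succ, eq_add_of_sub_eq h, Finset.sum_Icc_succ_top (by omega),
      Finset.prod_Icc_succ_top (by omega)]
    have h1 : gaussTerm q n n * (1 + q ^ n) =
        (-1) ^ n * 2 * (∏ i ∈ Icc 1 n, (1 + q ^ i)) * q ^ (n * (n + 1)) := by
      cases n with
      | zero => simp [gaussTerm]; norm_num
      | succ n =>
        simp only [gaussTerm]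
        rw [Finset.prod_Icc_succ_top (by omega : 1 ≤ n + 1)]
        simp
        ring
    have h2 : gaussTerm q (n + 1) (n + 1) =
        (-1) ^ (n + 1) * 2 * (∏ i ∈ Icc 1 n, (1 + q ^ i)) * q ^ ((n + 1) * (n + 2)) := by
      simp [gaussTerm]
    rw [h2]
    linear_combination (-q ^ (n + 1)) * h1

theorem dvd_gaussTerm (q : R) (n k : ℕ) : q ^ (n + 1) ∣ gaussTerm q n (k + 1) := by
  refine Dvd.dvd.mul_left (pow_dvd_pow q ?_) _
  nlinarith

/-- In `sum_gaussTerm` every term except the zeroth carries a factor q^(n+1), and the zeroth is the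
product of the 1 - q^i. -/
theorem pow_dvd_gauss (q : R) (n : ℕ) :
    q ^ (n + 1) ∣ (1 + 2 * ∑ k ∈ Icc 1 n, (-1) ^ k * q ^ (k ^ 2)) * ∏ i ∈ Icc 1 n, (1 + q ^ i)
      - ∏ i ∈ Icc 1 n, (1 - q ^ i) := by
  rw [← sum_gaussTerm, Finset.sum_range_succ']
  simp only [gaussTerm.eq_1, add_sub_cancel_right]
  exact Finset.dvd_sum fun k _ => dvd_gaussTerm q n k

end Gauss

/-! ### Series with exponents in one residue class -/

/-- All exponents of the series are congruent to `r` modulo `m`. -/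
def SupportedMod {A : Type*} [Semiring A] (m r : ℕ) (F : A⟦X⟧) : Prop :=
  ∀ n, coeff n F ≠ 0 → n ≡ r [MOD m]

namespace SupportedMod

variable {A : Type*} [CommRing A] {m r s : ℕ} {F G : A⟦X⟧}

theorem coeff_eq_zero (h : SupportedMod m r F) {n : ℕ} (hn : ¬ n ≡ r [MOD m]) :
    coeff n F = 0 := by
  by_contra h'
  exact hn (h n h')

theorem add (hF : SupportedMod m r F) (hG : SupportedMod m r G) : SupportedMod m r (F + G) := by
  intro n hn
  by_contra h
  exact hn (by rw [map_add, hF.coeff_eq_zero h, hG.coeff_eq_zero h, add_zero])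

theorem neg (hF : SupportedMod m r F) : SupportedMod m r (-F) := by
  intro n hn
  by_contra h
  exact hn (by rw [map_neg, hF.coeff_eq_zero h, neg_zero])

theorem sub (hF : SupportedMod m r F) (hG : SupportedMod m r G) : SupportedMod m r (F - G) := by
  rw [sub_eq_add_neg]
  exact hF.add hG.neg

theorem mul (hF : SupportedMod m r F) (hG : SupportedMod m s G) :
    SupportedMod m (r + s) (F * G) := by
  intro n hn
  rw [coeff_mul] at hn
  obtain ⟨a, ha, h⟩ := Finset.exists_ne_zero_of_sum_ne_zero hn
  rw [HasAntidiagonal.mem_antidiagonal] at ha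
  rw [← ha]
  exact (hF _ (left_ne_zero_of_mul h)).add (hG _ (right_ne_zero_of_mul h))

theorem of_modEq (hF : SupportedMod m r F) (h : r ≡ s [MOD m]) : SupportedMod m s F :=
  fun n hn => (hF n hn).trans h

theorem of_dvd {k : ℕ} (hF : SupportedMod m r F) (h : k ∣ m) : SupportedMod k r F :=
  fun n hn => (hF n hn).of_dvd h

theorem one : SupportedMod m 0 (1 : A⟦X⟧) := by
  intro n hn
  rw [coeff_one] at hn
  have : n = 0 := by
    by_contra h
    simp [h] at hn
  rw [this]

theorem pow (hF : SupportedMod m 0 F) (k : ℕ) : SupportedMod m 0 (F ^ k) := by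
  induction k with
  | zero => simpa using one
  | succ k ih => simpa [pow_succ] using ih.mul hF

theorem natCast (k : ℕ) : SupportedMod m 0 (k : A⟦X⟧) := by
  induction k with
  | zero => intro n hn; simp at hn
  | succ k ih => rw [Nat.cast_succ]; exact ih.add one

theorem ofNat (k : ℕ) [k.AtLeastTwo] : SupportedMod m 0 (ofNat(k) : A⟦X⟧) := by
  exact_mod_cast natCast (A := A) (m := m) k

theorem mul_zero_class (hF : SupportedMod m r F) (hG : SupportedMod m 0 G) :
    SupportedMod m r (F * G) := by simpa using hF.mul hG

theorem zero_class_mul (hF : SupportedMod m 0 F) (hG : SupportedMod m r G) :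
    SupportedMod m r (F * G) := by simpa using hF.mul hG

theorem expand {d : ℕ} (hd : d ≠ 0) (hF : SupportedMod m r F) :
    SupportedMod (d * m) (d * r) (PowerSeries.expand d hd F) := by
  intro n hn
  rw [coeff_expand] at hn
  split_ifs at hn with h
  · obtain ⟨k, rfl⟩ := h
    rw [Nat.mul_div_cancel_left _ (Nat.pos_of_ne_zero hd)] at hn
    exact Nat.ModEq.mul_left' d (hF k hn)
  · exact absurd rfl hn

theorem expand_zero {d : ℕ} (hd : d ≠ 0) (F : A⟦X⟧) :
    SupportedMod d 0 (PowerSeries.expand d hd F) := by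
  have : SupportedMod 1 0 F := fun n _ => Nat.modEq_one
  simpa using this.expand hd

theorem map {B : Type*} [CommRing B] (f : A →+* B) (hF : SupportedMod m r F) :
    SupportedMod m r (PowerSeries.map f F) := by
  intro n hn
  refine hF n fun h => hn ?_
  rw [coeff_map, h, map_zero]

end SupportedMod

/-! ### Dissections of theta series at the prime 2 -/

/-- The series `F(q ^ (2 ^ i))`. -/
noncomputable def dilate (i : ℕ) : ℤ⟦X⟧ →ₐ[ℤ] ℤ⟦X⟧ := PowerSeries.expand (2 ^ i) (by positivity)

theorem expand_congr {A : Type*} [CommRing A] {a b : ℕ} (h : a = b) (ha : a ≠ 0) (hb : b ≠ 0)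
    (F : A⟦X⟧) : PowerSeries.expand a ha F = PowerSeries.expand b hb F := by
  subst h
  rfl

theorem dilate_dilate (i j : ℕ) (F : ℤ⟦X⟧) : dilate i (dilate j F) = dilate (i + j) F := by
  rw [dilate, dilate, dilate, ← PowerSeries.expand_mul]
  exact expand_congr (pow_add 2 i j).symm _ _ F

theorem dilate_zero (F : ℤ⟦X⟧) : dilate 0 F = F := by
  rw [dilate, expand_congr (pow_zero 2) _ one_ne_zero, PowerSeries.expand_one_apply]

theorem supportedMod_dilate (i : ℕ) (F : ℤ⟦X⟧) : SupportedMod (2 ^ i) 0 (dilate i F) :=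
  SupportedMod.expand_zero _ F

/-- The theta series `∑ q ^ (x ^ 2)` over all integers `x`. -/
noncomputable def squareSeries : ℤ⟦X⟧ :=
  PowerSeries.mk fun n => if n = 0 then 1 else if IsSquare n then 2 else 0

/-- The series `∑ q ^ (x ^ 2)` over the odd positive integers `x`. -/
noncomputable def oddSquareSeries : ℤ⟦X⟧ :=
  PowerSeries.mk fun n => if IsSquare n ∧ Odd n then 1 else 0

/-- The theta series `∑ (-1) ^ x q ^ (x ^ 2)` over all integers `x`. -/
noncomputable def altSquareSeries : ℤ⟦X⟧ := dilate 2 squareSeries - 2 * oddSquareSeries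

theorem supportedMod_oddSquareSeries : SupportedMod 8 1 oddSquareSeries := by
  intro n hn
  rw [oddSquareSeries, coeff_mk] at hn
  split_ifs at hn with h
  · obtain ⟨⟨x, rfl⟩, ho⟩ := h
    have hx : Odd x := (Nat.odd_mul.1 ho).1
    have h8 : x % 8 = 1 ∨ x % 8 = 3 ∨ x % 8 = 5 ∨ x % 8 = 7 := by
      have := Nat.odd_iff.1 hx
      omega
    rw [Nat.ModEq, Nat.mul_mod]
    rcases h8 with h | h | h | h <;> simp [h]
  · exact absurd rfl hn

theorem squareSeries_eq : squareSeries = dilate 2 squareSeries + 2 * oddSquareSeries := by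
  ext n
  have h2 : (2 : ℤ⟦X⟧) = C (2 : ℤ) := by simp
  rw [map_add, h2, coeff_C_mul, dilate, coeff_expand]
  simp only [squareSeries, oddSquareSeries, coeff_mk]
  have h4 : (2 ^ 2 ∣ n) ↔ n % 4 = 0 := by
    norm_num [Nat.dvd_iff_mod_eq_zero]
  have hsq : IsSquare n → n % 4 = 0 ∧ IsSquare (n / 4) ∨ n % 2 = 1 := by
    rintro ⟨x, rfl⟩
    rcases Nat.even_or_odd' x with ⟨y, rfl | rfl⟩
    · left
      have : 2 * y * (2 * y) = 4 * (y * y) := by ring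
      rw [this]
      refine ⟨by omega, ?_⟩
      rw [Nat.mul_div_cancel_left _ (by norm_num)]
      exact ⟨y, rfl⟩
    · right
      have : (2 * y + 1) * (2 * y + 1) = 2 * (2 * y * y + 2 * y) + 1 := by ring
      omega
  have hsq' : n % 4 = 0 → IsSquare (n / 4) → IsSquare n := by
    rintro h ⟨y, hy⟩
    refine ⟨2 * y, ?_⟩
    have : 2 * y * (2 * y) = 4 * (y * y) := by ring
    omega
  by_cases h0 : n = 0
  · simp [h0]
  by_cases h : n % 4 = 0
  · have h1 : n / 2 ^ 2 ≠ 0 := by omega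
    have h3 : IsSquare n ↔ IsSquare (n / 2 ^ 2) := by
      refine ⟨fun hs => ?_, hsq' h⟩
      rcases hsq hs with h' | h'
      · exact h'.2
      · omega
    have h5 : ¬ Odd n := by rw [Nat.odd_iff]; omega
    rw [if_neg h0, if_pos (h4.2 h), if_neg h1]
    simp only [h3, h5, and_false, if_false]
    simp
  · rw [if_neg h0, if_neg (fun hh => h (h4.1 hh))]
    by_cases hs : IsSquare n
    · have : Odd n := by
        rw [Nat.odd_iff]
        rcases hsq hs with h' | h' <;> omega
      simp [hs, this]
    · simp [hs]

theorem altSquareSeries_eq : altSquareSeries = squareSeries - 4 * oddSquareSeries := by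
  rw [altSquareSeries]
  linear_combination (-1 : ℤ⟦X⟧) * squareSeries_eq

theorem coeff_squareSeries (n N : ℕ) (h : n ≤ N) :
    coeff n squareSeries = (((Icc (-N : ℤ) N).filter fun x : ℤ => x ^ 2 = (n : ℤ)).card : ℤ) := by
  rw [squareSeries, coeff_mk]
  split_ifs with h0 hs
  · subst h0
    have : (Icc (-N : ℤ) N).filter (fun x : ℤ => x ^ 2 = ((0 : ℕ) : ℤ)) = {0} := by
      ext x
      simp only [Finset.mem_filter, Finset.mem_Icc, Finset.mem_singleton]
      constructor
      · rintro ⟨_, h⟩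
        simpa using h
      · rintro rfl
        simp
    rw [this]
    simp
  · obtain ⟨k, rfl⟩ := hs
    have hk : 0 < k := Nat.pos_of_ne_zero fun h => h0 (by simp [h])
    have : (Icc (-N : ℤ) N).filter (fun x : ℤ => x ^ 2 = ((k * k : ℕ) : ℤ)) = {(k : ℤ), -(k : ℤ)} := by
      ext x
      simp only [Finset.mem_filter, Finset.mem_Icc, Finset.mem_singleton, Finset.mem_insert]
      have hkk : k ≤ k * k := Nat.le_mul_self k
      constructor
      · rintro ⟨_, h⟩
        push_cast at h
        exact sq_eq_sq_iff_eq_or_eq_neg.1 (by rw [h]; ring)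
      · rintro (rfl | rfl)
        · exact ⟨by omega, by push_cast; ring⟩
        · exact ⟨by omega, by push_cast; ring⟩
    rw [this, Finset.card_pair (by omega)]
    rfl
  · have : (Icc (-N : ℤ) N).filter (fun x : ℤ => x ^ 2 = (n : ℤ)) = ∅ := by
      refine Finset.filter_eq_empty_iff.2 fun x _ h => hs ⟨x.natAbs, ?_⟩
      zify
      rw [← sq, sq_abs, h]
    rw [this]
    simp

theorem coeff_squareSeries_sq (n N : ℕ) (h : n ≤ N) :
    coeff n (squareSeries ^ 2) =
      (((Icc (-N : ℤ) N ×ˢ Icc (-N : ℤ) N).filter fun x : ℤ × ℤ =>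
        x.1 ^ 2 + x.2 ^ 2 = (n : ℤ)).card : ℤ) := by
  rw [Finset.card_eq_sum_card_fiberwise (f := fun x : ℤ × ℤ => (x.1.natAbs ^ 2, x.2.natAbs ^ 2))
    (t := antidiagonal n), sq, coeff_mul]
  · push_cast
    refine Finset.sum_congr rfl fun a ha => ?_
    rw [HasAntidiagonal.mem_antidiagonal] at ha
    rw [coeff_squareSeries _ N (by omega), coeff_squareSeries _ N (by omega), ← Nat.cast_mul,
      ← Finset.card_product, Nat.cast_inj]
    congr 1
    ext ⟨x, y⟩
    simp only [Finset.mem_product, Finset.mem_filter, Prod.ext_iff]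
    have hx : x.natAbs ^ 2 = a.1 ↔ x ^ 2 = a.1 := by zify; rw [sq_abs]
    have hy : y.natAbs ^ 2 = a.2 ↔ y ^ 2 = a.2 := by zify; rw [sq_abs]
    rw [hx, hy]
    constructor
    · rintro ⟨⟨h1, h2⟩, h3, h4⟩
      refine ⟨⟨⟨h1, h3⟩, ?_⟩, h2, h4⟩
      rw [h2, h4, ← ha]
      push_cast
      ring
    · rintro ⟨⟨⟨h1, h3⟩, _⟩, h2, h4⟩
      exact ⟨⟨h1, h2⟩, h3, h4⟩
  · rintro ⟨x, y⟩ hx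
    simp only [Finset.coe_filter, Set.mem_ofPred_eq] at hx
    simp only [Finset.mem_coe, HasAntidiagonal.mem_antidiagonal]
    zify
    rw [sq_abs, sq_abs, hx.2]

/-- The map (x, y) ↦ (x + y, x - y) is a bijection from the representations of n as a sum of two
squares to those of 2n; surjectivity holds because x² + y² even forces x + y even. -/
theorem coeff_two_mul_squareSeries_sq (n : ℕ) :
    coeff (2 * n) (squareSeries ^ 2) = coeff n (squareSeries ^ 2) := by
  rw [coeff_squareSeries_sq (2 * n) (2 * n) le_rfl, coeff_squareSeries_sq n (2 * n) (by omega),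
    Nat.cast_inj]
  symm
  refine Finset.card_bij (fun x _ => (x.1 + x.2, x.1 - x.2)) ?_ ?_ ?_
  · rintro ⟨x, y⟩ h
    simp only [Finset.mem_product, Finset.mem_filter, Finset.mem_Icc] at h ⊢
    have h1 : (x + y) ^ 2 + (x - y) ^ 2 = (2 * n : ℕ) := by
      push_cast
      linear_combination 2 * h.2
    have h2 := h.2
    push_cast at h1 ⊢
    refine ⟨⟨⟨?_, ?_⟩, ?_, ?_⟩, h1⟩ <;>
      nlinarith [Int.le_self_sq x, Int.le_self_sq y, Int.le_self_sq (-x), Int.le_self_sq (-y)]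
  · rintro ⟨x, y⟩ _ ⟨z, w⟩ _ h
    simp only [Prod.mk.injEq] at h ⊢
    omega
  · rintro ⟨x, y⟩ h
    simp only [Finset.mem_product, Finset.mem_filter, Finset.mem_Icc] at h
    have hpar : (x + y) % 2 = 0 := by
      have h1 := h.2
      have h3 : (x + y) ^ 2 = 2 * (n + x * y) := by push_cast at h1; linear_combination h1
      have : Even ((x + y) ^ 2) := ⟨n + x * y, by rw [h3]; ring⟩
      rw [Int.even_pow] at this
      exact Int.even_iff.1 this.1
    obtain ⟨u, hu⟩ : ∃ u, x + y = 2 * u := ⟨(x + y) / 2, by omega⟩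
    obtain ⟨v, hv⟩ : ∃ v, x - y = 2 * v := ⟨(x - y) / 2, by omega⟩
    have hx : x = u + v := by omega
    have hy : y = u - v := by omega
    subst hx hy
    refine ⟨(u, v), ?_, rfl⟩
    have h1 := h.2
    push_cast at h1 h
    simp only [Finset.mem_product, Finset.mem_filter, Finset.mem_Icc]
    push_cast
    refine ⟨⟨⟨?_, ?_⟩, ?_, ?_⟩, by linarith⟩ <;> omega

/-- Squaring φ(q) = φ(q⁴) + 2V(q), the cross term is exactly the odd part; the even part is φ(q²)²
by `coeff_two_mul_squareSeries_sq`. -/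
theorem squareSeries_sq :
    squareSeries ^ 2 = dilate 1 squareSeries ^ 2 + 4 * (dilate 2 squareSeries * oddSquareSeries) := by
  have h4 : (4 : ℤ⟦X⟧) = C (4 : ℤ) := by simp
  have hV := supportedMod_oddSquareSeries.of_dvd (by norm_num : 2 ∣ 8)
  have hP := (supportedMod_dilate 2 squareSeries).of_dvd (by norm_num : 2 ∣ 2 ^ 2)
  have hodd : SupportedMod 2 1 (4 * (dilate 2 squareSeries * oddSquareSeries)) :=
    (SupportedMod.ofNat 4).zero_class_mul (hP.zero_class_mul hV)
  have hev : SupportedMod 2 0 (dilate 2 squareSeries ^ 2 + 4 * (oddSquareSeries * oddSquareSeries)) :=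
    (hP.pow 2).add ((SupportedMod.ofNat 4).zero_class_mul ((hV.mul hV).of_modEq rfl))
  have hdec : squareSeries ^ 2 = 4 * (dilate 2 squareSeries * oddSquareSeries) +
      (dilate 2 squareSeries ^ 2 + 4 * (oddSquareSeries * oddSquareSeries)) := by
    conv_lhs => rw [squareSeries_eq]
    ring
  ext n
  rcases Nat.even_or_odd' n with ⟨k, rfl | rfl⟩
  · have h1 : coeff (2 * k) (4 * (dilate 2 squareSeries * oddSquareSeries)) = 0 :=
      hodd.coeff_eq_zero (by rw [Nat.ModEq]; omega)
    rw [map_add, h1, add_zero, ← map_pow, dilate]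
    have := coeff_expand_mul 2 two_ne_zero (squareSeries ^ 2) k
    rw [expand_congr (pow_one 2) _ two_ne_zero, this, coeff_two_mul_squareSeries_sq]
  · have h1 := hev.coeff_eq_zero (n := 2 * k + 1) (by rw [Nat.ModEq]; omega)
    have h2 := (supportedMod_dilate 1 (squareSeries ^ 2)).coeff_eq_zero (n := 2 * k + 1)
      (by rw [Nat.ModEq]; omega)
    rw [map_pow] at h2
    rw [hdec, map_add, h1, map_add, h2, zero_add, add_zero]

theorem dilate_one_squareSeries_sq :
    dilate 1 squareSeries ^ 2 = dilate 2 squareSeries ^ 2 + 4 * oddSquareSeries ^ 2 := by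
  have h := squareSeries_sq
  have h' : squareSeries ^ 2 = (dilate 2 squareSeries + 2 * oddSquareSeries) ^ 2 := by
    rw [← squareSeries_eq]
  linear_combination h' - h

/-- Two expressions for φ(q²)² are compared: `squareSeries_sq` at q² and
`dilate_one_squareSeries_sq`. The factor 4 cancels over ℤ. -/
theorem oddSquareSeries_sq :
    oddSquareSeries ^ 2 = dilate 3 squareSeries * dilate 1 oddSquareSeries := by
  have h := congrArg (dilate 1) squareSeries_sq
  simp only [map_add, map_mul, map_pow, map_ofNat, dilate_dilate] at h
  have h4 : (4 : ℤ⟦X⟧) ≠ 0 := by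
    have : (4 : ℤ⟦X⟧) = C (4 : ℤ) := by simp
    rw [this, Ne, map_eq_zero_iff _ C_injective]
    norm_num
  refine mul_left_cancel₀ h4 ?_
  linear_combination h - dilate_one_squareSeries_sq

theorem squareSeries_mul_altSquareSeries :
    squareSeries * altSquareSeries = dilate 1 altSquareSeries ^ 2 := by
  rw [altSquareSeries, map_sub, map_mul, map_ofNat, dilate_dilate]
  have h1 : squareSeries = dilate 2 squareSeries + 2 * oddSquareSeries := squareSeries_eq
  have h3 := congrArg (dilate 1) dilate_one_squareSeries_sq
  have h4 := oddSquareSeries_sq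
  simp only [map_add, map_mul, map_pow, map_ofNat, dilate_dilate] at h3
  norm_num at h3 ⊢
  linear_combination (dilate 2 squareSeries - 2 * oddSquareSeries) * h1 + h3 - 4 * h4

/-! ### The generating series as a reciprocal of theta series -/

theorem coeff_altSquareSeries (n N : ℕ) (h : n ≤ N) :
    coeff n altSquareSeries = coeff n
      (1 + 2 * ∑ k ∈ Icc 1 N, (-1) ^ k * X ^ (k ^ 2) : ℤ⟦X⟧) := by
  have h4 : (4 : ℤ⟦X⟧) = C (4 : ℤ) := by simp
  have h2 : (2 : ℤ⟦X⟧) = C (2 : ℤ) := by simp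
  have hm : ∀ k : ℕ, ((-1) ^ k : ℤ⟦X⟧) = C ((-1) ^ k : ℤ) := by simp
  rw [altSquareSeries_eq, map_sub, map_add, h4, h2, coeff_C_mul, coeff_C_mul, map_sum, coeff_one]
  simp only [hm, coeff_C_mul, coeff_X_pow, squareSeries, oddSquareSeries, coeff_mk]
  by_cases hs : IsSquare n
  · obtain ⟨m, rfl⟩ := hs
    by_cases h0 : m = 0
    · subst h0
      have : ∀ k ∈ Icc 1 N, (-1 : ℤ) ^ k * (if 0 * 0 = k ^ 2 then 1 else 0) = 0 := by
        intro k hk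
        rw [Finset.mem_Icc] at hk
        rw [if_neg, mul_zero]
        have := pow_pos (show 0 < k by omega) 2
        omega
      rw [Finset.sum_eq_zero this]
      simp
    · have hmm : m ≤ m * m := Nat.le_mul_self m
      have hne : m * m ≠ 0 := by positivity
      rw [Finset.sum_eq_single m]
      · rw [if_neg hne, if_neg hne, if_pos (IsSquare.mul_self m), if_pos (sq m).symm]
        rcases Nat.even_or_odd m with he | ho
        · have : ¬ Odd (m * m) := by
            rw [Nat.not_odd_iff_even]
            exact he.mul_left m
          simp [this, he.neg_one_pow]
        · simp [ho.mul ho, ho.neg_one_pow]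
      · intro k _ hk
        rw [if_neg, mul_zero]
        intro h'
        rw [sq] at h'
        exact hk (Nat.mul_self_inj.1 h').symm
      · intro h'
        exact absurd (Finset.mem_Icc.2 ⟨by omega, by omega⟩) h'
  · have h0 : n ≠ 0 := by
      rintro rfl
      exact hs (IsSquare.zero)
    rw [Finset.sum_eq_zero]
    · simp [hs, h0]
    · intro k _
      rw [if_neg, mul_zero]
      rintro rfl
      exact hs ⟨k, sq k⟩

theorem X_pow_dvd_altSquareSeries (n : ℕ) :
    X ^ (n + 1) ∣ altSquareSeries * ∏ i ∈ Icc 1 n, (1 + X ^ i) - ∏ i ∈ Icc 1 n, (1 - X ^ i) := by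
  have h1 : X ^ (n + 1) ∣ altSquareSeries -
      (1 + 2 * ∑ k ∈ Icc 1 n, (-1) ^ k * X ^ (k ^ 2) : ℤ⟦X⟧) := by
    rw [X_pow_dvd_iff]
    intro m hm
    rw [map_sub, coeff_altSquareSeries m n (by omega), sub_self]
  have h2 := pow_dvd_gauss (X : ℤ⟦X⟧) n
  have := dvd_add (h1.mul_right (∏ i ∈ Icc 1 n, (1 + X ^ i))) h2
  convert this using 1
  ring

theorem X_pow_dvd_dilate_altSquareSeries (n : ℕ) :
    X ^ (n + 1) ∣ dilate 1 altSquareSeries * ∏ i ∈ Icc 1 n, (1 + X ^ (2 * i)) -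
      ∏ i ∈ Icc 1 n, (1 - X ^ (2 * i)) := by
  have hX : dilate 1 (X : ℤ⟦X⟧) = X ^ 2 := by simp [dilate]
  obtain ⟨F, hF⟩ := X_pow_dvd_altSquareSeries n
  have h := congrArg (dilate 1) hF
  simp only [map_sub, map_mul, map_prod, map_add, map_one, map_pow, hX, ← pow_mul] at h
  rw [h]
  exact Dvd.dvd.mul_right (pow_dvd_pow X (by omega)) _

theorem isUnit_prod_one_add (n c : ℕ) (hc : 0 < c) :
    IsUnit (∏ i ∈ Icc 1 n, (1 + X ^ (c * i)) : ℤ⟦X⟧) := by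
  rw [isUnit_iff_constantCoeff, map_prod, Finset.prod_eq_one]
  · exact isUnit_one
  · intro i hi
    rw [Finset.mem_Icc] at hi
    have : c * i ≠ 0 := Nat.mul_ne_zero hc.ne' (by omega)
    simp [this]

/-- The generating series of the overcubic partitions is `1 / (φ(-q) φ(-q ^ 2))`. -/
theorem overcubicSeries_mul :
    overcubicSeries * (altSquareSeries * dilate 1 altSquareSeries) = 1 := by
  ext n
  set F : ℤ⟦X⟧ := ∏ k ∈ Icc 1 n, (partFactor k * partFactor (2 * k)) with hF
  set a : ℤ⟦X⟧ := ∏ i ∈ Icc 1 n, (1 + X ^ i) with ha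
  set b : ℤ⟦X⟧ := ∏ i ∈ Icc 1 n, (1 - X ^ i) with hb
  set c : ℤ⟦X⟧ := ∏ i ∈ Icc 1 n, (1 + X ^ (2 * i)) with hc
  set d : ℤ⟦X⟧ := ∏ i ∈ Icc 1 n, (1 - X ^ (2 * i)) with hd
  have h1 : F * (b * d) = a * c := by
    rw [hF, ha, hb, hc, hd, ← Finset.prod_mul_distrib, ← Finset.prod_mul_distrib,
      ← Finset.prod_mul_distrib]
    refine Finset.prod_congr rfl fun k hk => ?_
    rw [Finset.mem_Icc] at hk
    rw [← partFactor_mul k (by omega), ← partFactor_mul (2 * k) (by omega)]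
    ring
  have h2 : X ^ (n + 1) ∣ altSquareSeries * a - b := X_pow_dvd_altSquareSeries n
  have h3 : X ^ (n + 1) ∣ dilate 1 altSquareSeries * c - d := X_pow_dvd_dilate_altSquareSeries n
  have h4 : X ^ (n + 1) ∣ overcubicSeries - F := by
    rw [X_pow_dvd_iff]
    intro m hm
    rw [map_sub, overcubicSeries_coeff m n (by omega), sub_self]
  have hu : IsUnit (a * c) := by
    refine IsUnit.mul ?_ (isUnit_prod_one_add n 2 (by norm_num))
    have := isUnit_prod_one_add n 1 one_pos
    simp only [one_mul] at this
    exact this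
  -- The finite product and the two theta series are replaced by their truncated forms one at a
  -- time, each replacement costing a multiple of X^(n+1); the unit `a * c` is cancelled afterwards.
  have h5 : X ^ (n + 1) ∣
      (overcubicSeries * (altSquareSeries * dilate 1 altSquareSeries) - 1) * (a * c) := by
    have e1 := h4.mul_right (altSquareSeries * dilate 1 altSquareSeries * (a * c))
    have e2 := h2.mul_right (F * (dilate 1 altSquareSeries * c))
    have e3 := h3.mul_right (F * b)
    convert dvd_add (dvd_add e1 e2) e3 using 1
    linear_combination h1
  have h6 := (IsUnit.dvd_mul_right hu).1 h5
  rw [X_pow_dvd_iff] at h6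
  have h7 := h6 n (by omega)
  rw [map_sub, sub_eq_zero] at h7
  exact h7

/-! ### Dissections modulo 3 and the divisibility by 4 -/

/-- The terms of the series whose exponents are congruent to `r` modulo `m`. -/
noncomputable def residuePart {A : Type*} [CommRing A] (m r : ℕ) (F : A⟦X⟧) : A⟦X⟧ :=
  PowerSeries.mk fun n => if n % m = r then coeff n F else 0

section residuePart

variable {A : Type*} [CommRing A] {m r s : ℕ}

theorem residuePart_add (F G : A⟦X⟧) :
    residuePart m r (F + G) = residuePart m r F + residuePart m r G := by
  ext n
  simp only [residuePart, coeff_mk, map_add]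
  split_ifs <;> simp

theorem residuePart_of_supported {F : A⟦X⟧} (h : SupportedMod m s F) (hr : s % m = r) :
    residuePart m r F = F := by
  ext n
  rw [residuePart, coeff_mk]
  split_ifs with hn
  · rfl
  · exact (h.coeff_eq_zero fun h' => hn (Eq.trans h' hr)).symm

theorem residuePart_of_not {F : A⟦X⟧} (h : SupportedMod m s F) (hr : s % m ≠ r) :
    residuePart m r F = 0 := by
  ext n
  rw [residuePart, coeff_mk, map_zero]
  split_ifs with hn
  · refine h.coeff_eq_zero fun h' => hr ?_
    rw [← hn]
    exact h'.symm
  · rfl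

theorem eq_sum_residuePart_three (F : A⟦X⟧) :
    F = residuePart 3 0 F + residuePart 3 1 F + residuePart 3 2 F := by
  ext n
  simp only [residuePart, map_add, coeff_mk]
  have : n % 3 = 0 ∨ n % 3 = 1 ∨ n % 3 = 2 := by omega
  rcases this with h | h | h <;> simp [h]

theorem supportedMod_residuePart (F : A⟦X⟧) : SupportedMod m r (residuePart m r F) := by
  intro n hn
  rw [residuePart, coeff_mk] at hn
  split_ifs at hn with h
  · rw [← h]
    exact (Nat.mod_modEq n m).symm
  · exact absurd rfl hn

end residuePart

theorem sq_mod_three (x : ℕ) : x * x % 3 = if 3 ∣ x then 0 else 1 := by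
  rw [Nat.mul_mod]
  have : x % 3 = 0 ∨ x % 3 = 1 ∨ x % 3 = 2 := by omega
  split_ifs with h
  · rw [Nat.dvd_iff_mod_eq_zero] at h
    simp [h]
  · rw [Nat.dvd_iff_mod_eq_zero] at h
    rcases this with h' | h' | h'
    · exact absurd h' h
    · simp [h']
    · simp [h']

/-- The part of `oddSquareSeries` from the integers that 3 does not divide. -/
noncomputable def oddSquareSeriesA : ℤ⟦X⟧ := residuePart 3 1 oddSquareSeries

/-- The part of `oddSquareSeries` from the multiples of 3. -/
noncomputable def oddSquareSeriesB : ℤ⟦X⟧ := residuePart 3 0 oddSquareSeries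

/-- The series `∑ q ^ (x ^ 2)` over the positive integers `x` that 3 does not divide. -/
noncomputable def halfSquareSeriesA : ℤ⟦X⟧ :=
  PowerSeries.mk fun n => if IsSquare n ∧ n % 3 = 1 then 1 else 0

/-- The part of `squareSeries` from the multiples of 3. -/
noncomputable def squareSeriesB : ℤ⟦X⟧ := residuePart 3 0 squareSeries

theorem isSquare_mod_three {n : ℕ} (h : IsSquare n) : n % 3 ≠ 2 := by
  obtain ⟨x, rfl⟩ := h
  rw [sq_mod_three]
  split_ifs <;> norm_num

theorem oddSquareSeries_eq_add : oddSquareSeries = oddSquareSeriesA + oddSquareSeriesB := by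
  have h2 : residuePart 3 2 oddSquareSeries = 0 := by
    ext n
    rw [residuePart, coeff_mk, oddSquareSeries, coeff_mk, map_zero]
    split_ifs with h h'
    · exact absurd h (isSquare_mod_three h'.1)
    · rfl
    · rfl
  conv_lhs => rw [eq_sum_residuePart_three oddSquareSeries, h2]
  rw [oddSquareSeriesA, oddSquareSeriesB]
  ring

theorem squareSeries_eq_add : squareSeries = 2 * halfSquareSeriesA + squareSeriesB := by
  have h2 : residuePart 3 2 squareSeries = 0 := by
    ext n
    rw [residuePart, coeff_mk, squareSeries, coeff_mk, map_zero]
    split_ifs with h h' h''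
    · omega
    · exact absurd h (isSquare_mod_three h'')
    · rfl
    · rfl
  have h1 : residuePart 3 1 squareSeries = 2 * halfSquareSeriesA := by
    have hC : (2 : ℤ⟦X⟧) = C (2 : ℤ) := by simp
    ext n
    rw [hC, coeff_C_mul, residuePart, coeff_mk, squareSeries, coeff_mk, halfSquareSeriesA, coeff_mk]
    by_cases h : n % 3 = 1
    · have : n ≠ 0 := by rintro rfl; simp at h
      simp [h, this]
    · simp [h]
  conv_lhs => rw [eq_sum_residuePart_three squareSeries, h2, h1]
  rw [squareSeriesB]
  ring

theorem supportedMod_oddSquareSeriesA : SupportedMod 3 1 oddSquareSeriesA :=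
  supportedMod_residuePart _

theorem supportedMod_halfSquareSeriesA : SupportedMod 3 1 halfSquareSeriesA := by
  intro n hn
  rw [halfSquareSeriesA, coeff_mk] at hn
  split_ifs at hn with h
  · exact h.2
  · exact absurd rfl hn

theorem isSquare_mod_nine {n : ℕ} (h : IsSquare n) (h3 : n % 3 = 0) : n ≡ 0 [MOD 9] := by
  obtain ⟨x, rfl⟩ := h
  rw [sq_mod_three] at h3
  split_ifs at h3 with hx
  obtain ⟨y, rfl⟩ := hx
  rw [Nat.modEq_zero_iff_dvd]
  exact ⟨y * y, by ring⟩

theorem supportedMod_oddSquareSeriesB : SupportedMod 9 0 oddSquareSeriesB := by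
  intro n hn
  rw [oddSquareSeriesB, residuePart, coeff_mk] at hn
  split_ifs at hn with h
  · rw [oddSquareSeries, coeff_mk] at hn
    split_ifs at hn with h'
    · exact isSquare_mod_nine h'.1 h
    · exact absurd rfl hn
  · exact absurd rfl hn

theorem supportedMod_squareSeriesB : SupportedMod 9 0 squareSeriesB := by
  intro n hn
  rw [squareSeriesB, residuePart, coeff_mk] at hn
  split_ifs at hn with h
  · rw [squareSeries, coeff_mk] at hn
    split_ifs at hn with h' h''
    · rw [h']
    · exact isSquare_mod_nine h'' h
    · exact absurd rfl hn
  · exact absurd rfl hn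

theorem SupportedMod.dilate_three {r : ℕ} {F : ℤ⟦X⟧} (h : SupportedMod 3 r F) (i : ℕ) :
    SupportedMod 3 (2 ^ i * r) (dilate i F) :=
  (h.expand _).of_dvd (Dvd.intro_left _ rfl)

theorem SupportedMod.dilate_nine {F : ℤ⟦X⟧} (h : SupportedMod 9 0 F) (i : ℕ) :
    SupportedMod 9 0 (dilate i F) :=
  (h.expand _).of_dvd (Dvd.intro_left _ rfl)

/-- The three residue parts modulo 3 of `oddSquareSeries_sq`. -/
theorem residuePart_oddSquareSeries_sq :
    oddSquareSeriesA ^ 2 = 2 * (dilate 3 halfSquareSeriesA * dilate 1 oddSquareSeriesB) +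
        dilate 3 squareSeriesB * dilate 1 oddSquareSeriesA ∧
      oddSquareSeriesA * oddSquareSeriesB = dilate 3 halfSquareSeriesA * dilate 1 oddSquareSeriesA ∧
      oddSquareSeriesB ^ 2 = dilate 3 squareSeriesB * dilate 1 oddSquareSeriesB := by
  have hVa := supportedMod_oddSquareSeriesA
  have hVb := supportedMod_oddSquareSeriesB.of_dvd (by norm_num : 3 ∣ 9)
  have hV1a := hVa.dilate_three 1
  have hV1b := hVb.dilate_three 1
  have hE := supportedMod_halfSquareSeriesA.dilate_three 3
  have hP := (supportedMod_squareSeriesB.of_dvd (by norm_num : 3 ∣ 9)).dilate_three 3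
  have h := oddSquareSeries_sq
  rw [oddSquareSeries_eq_add, squareSeries_eq_add] at h
  simp only [map_add, map_mul, map_ofNat] at h
  set Va := oddSquareSeriesA
  set Vb := oddSquareSeriesB
  set Wa := dilate 1 Va
  set Wb := dilate 1 Vb
  set E := dilate 3 halfSquareSeriesA
  set P := dilate 3 squareSeriesB
  have h2 : ∀ r (F : ℤ⟦X⟧), SupportedMod 3 r F → SupportedMod 3 r (2 * F) := fun r F hF =>
    (SupportedMod.ofNat 2).zero_class_mul hF
  -- On each side the terms have exponents 2, 1 or 0 modulo 3, because `Va`, `E` and `Wa` have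
  -- exponents 1, 8 ≡ 2 and 2, and the others 0.
  have h' : Va * Va + 2 * (Va * Vb) + Vb * Vb =
      2 * (E * Wb) + P * Wa + 2 * (E * Wa) + P * Wb := by linear_combination h
  have s1 := hVa.mul hVa
  have s2 := h2 _ _ (hVa.mul hVb)
  have s3 := hVb.mul hVb
  have s4 := h2 _ _ (hE.mul hV1b)
  have s5 := hP.mul hV1a
  have s6 := h2 _ _ (hE.mul hV1a)
  have s7 := hP.mul hV1b
  have key := fun r => congrArg (residuePart 3 r) h'
  simp only [residuePart_add] at key
  refine ⟨?_, ?_, ?_⟩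
  · have k := key 2
    rw [residuePart_of_supported s1 (by norm_num), residuePart_of_not s2 (by norm_num),
      residuePart_of_not s3 (by norm_num), residuePart_of_supported s4 (by norm_num),
      residuePart_of_supported s5 (by norm_num), residuePart_of_not s6 (by norm_num),
      residuePart_of_not s7 (by norm_num)] at k
    linear_combination k
  · have k := key 1
    rw [residuePart_of_not s1 (by norm_num), residuePart_of_supported s2 (by norm_num),
      residuePart_of_not s3 (by norm_num), residuePart_of_not s4 (by norm_num),
      residuePart_of_not s5 (by norm_num), residuePart_of_supported s6 (by norm_num),
      residuePart_of_not s7 (by norm_num)] at k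
    have h20 : (2 : ℤ⟦X⟧) ≠ 0 := by
      have : (2 : ℤ⟦X⟧) = C (2 : ℤ) := by simp
      rw [this, Ne, map_eq_zero_iff _ C_injective]
      norm_num
    refine mul_left_cancel₀ h20 ?_
    linear_combination k
  · have k := key 0
    rw [residuePart_of_not s1 (by norm_num), residuePart_of_not s2 (by norm_num),
      residuePart_of_supported s3 (by norm_num), residuePart_of_not s4 (by norm_num),
      residuePart_of_not s5 (by norm_num), residuePart_of_not s6 (by norm_num),
      residuePart_of_supported s7 (by norm_num)] at k
    linear_combination k

theorem map_two_sq (F : ℤ⟦X⟧) : PowerSeries.map (Int.castRingHom (ZMod 2)) F ^ 2 =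
    PowerSeries.map (Int.castRingHom (ZMod 2)) (dilate 1 F) := by
  rw [dilate, map_expand, expand_congr (pow_one 2) _ two_ne_zero]
  have := MvPowerSeries.map_frobenius_expand (σ := Unit) (R := ZMod 2) 2 two_ne_zero
    (f := PowerSeries.map (Int.castRingHom (ZMod 2)) F)
  rw [← this, ZMod.frobenius_zmod]
  simp [PowerSeries.expand]

/-- Modulo 2, squaring is q ↦ q², so the middle identity of `residuePart_oddSquareSeries_sq` has a
factor `oddSquareSeriesA` on both sides, which cancels in a domain. -/
theorem map_two_half_mul :
    PowerSeries.map (Int.castRingHom (ZMod 2)) (dilate 3 halfSquareSeriesA * oddSquareSeriesA) =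
      PowerSeries.map (Int.castRingHom (ZMod 2)) oddSquareSeriesB := by
  obtain ⟨-, h, -⟩ := residuePart_oddSquareSeries_sq
  have h' := congrArg (PowerSeries.map (Int.castRingHom (ZMod 2))) h
  rw [map_mul, map_mul, ← map_two_sq] at h'
  have h0 : PowerSeries.map (Int.castRingHom (ZMod 2)) oddSquareSeriesA ≠ 0 := by
    intro h
    have := congrArg (coeff 1) h
    rw [coeff_map, oddSquareSeriesA, residuePart, coeff_mk, oddSquareSeries, coeff_mk] at this
    simp at this
  refine mul_left_cancel₀ h0 ?_
  rw [h', map_mul]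
  ring

/-- The number of representations of `M` as `x ^ 2 + y ^ 2 + z ^ 2 + 2 w ^ 2` with odd positive
integers is a multiple of 4 if 3 divides `M` exactly once. -/
theorem four_dvd_coeff (M : ℕ) (h3 : M % 3 = 0) (h9 : M % 9 ≠ 0) :
    (4 : ℤ) ∣ coeff M (oddSquareSeries ^ 3 * dilate 1 oddSquareSeries) := by
  obtain ⟨e1, e2, e3⟩ := residuePart_oddSquareSeries_sq
  have hVa := supportedMod_oddSquareSeriesA
  have hVb9 := supportedMod_oddSquareSeriesB
  have hWb9 := hVb9.dilate_nine 1
  have hVb := hVb9.of_dvd (by norm_num : 3 ∣ 9)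
  have hWa := hVa.dilate_three 1
  have hWb := hVb.dilate_three 1
  have hC : ∀ a : ℤ, ∀ F, coeff M (C a * F) = a * coeff M F := fun a F => coeff_C_mul _ _ _
  have hC4 : (4 : ℤ⟦X⟧) = C (4 : ℤ) := by simp
  have hC2 : (2 : ℤ⟦X⟧) = C (2 : ℤ) := by simp
  have hC3 : (3 : ℤ⟦X⟧) = C (3 : ℤ) := by simp
  have hmap := map_two_half_mul
  rw [oddSquareSeries_eq_add, map_add]
  set Va := oddSquareSeriesA
  set Vb := oddSquareSeriesB
  set Wa := dilate 1 Va
  set Wb := dilate 1 Vb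
  set E := dilate 3 halfSquareSeriesA
  set P := dilate 3 squareSeriesB
  -- Only `Va³ Wb`, `3 Va Vb² Wa` and `Vb³ Wb` have exponents divisible by 3. Rewriting `Va²` and
  -- `Vb²` turns the first two into 4 and 2 times a series: the coefficient 4 arises as 1 + 3.
  have hdec : (Va + Vb) ^ 3 * (Wa + Wb) = C (4 : ℤ) * (Va * Wb * (P * Wa)) +
      C (2 : ℤ) * (E * Va * (Wb * Wb)) + Vb * Vb * Vb * Wb +
      C (3 : ℤ) * (Va * Va * (Vb * Wb)) + C (3 : ℤ) * (Va * (Vb * Vb) * Wb) +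
      Va * Va * Va * Wa + C (3 : ℤ) * (Va * Va * (Vb * Wa)) + Vb * Vb * Vb * Wa := by
    rw [← hC4, ← hC2, ← hC3]
    linear_combination Va * Wb * e1 + 3 * Va * Wa * e3
  have z1 : coeff M (Vb * Vb * Vb * Wb) = 0 :=
    (((hVb9.mul hVb9).mul hVb9).mul hWb9).coeff_eq_zero h9
  have z2 : coeff M (Va * Va * (Vb * Wb)) = 0 :=
    ((hVa.mul hVa).mul (hVb.mul hWb)).coeff_eq_zero (by rw [Nat.ModEq]; omega)
  have z3 : coeff M (Va * (Vb * Vb) * Wb) = 0 :=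
    ((hVa.mul (hVb.mul hVb)).mul hWb).coeff_eq_zero (by rw [Nat.ModEq]; omega)
  have z4 : coeff M (Va * Va * Va * Wa) = 0 :=
    (((hVa.mul hVa).mul hVa).mul hWa).coeff_eq_zero (by rw [Nat.ModEq]; omega)
  have z5 : coeff M (Va * Va * (Vb * Wa)) = 0 :=
    ((hVa.mul hVa).mul (hVb.mul hWa)).coeff_eq_zero (by rw [Nat.ModEq]; omega)
  have z6 : coeff M (Vb * Vb * Vb * Wa) = 0 :=
    (((hVb.mul hVb).mul hVb).mul hWa).coeff_eq_zero (by rw [Nat.ModEq]; omega)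
  -- Modulo 2 the factor `E * Va` becomes `Vb`, leaving a product whose exponents are all multiples
  -- of 9.
  have z7 : (2 : ℤ) ∣ coeff M (E * Va * (Wb * Wb)) := by
    have h1 : ((coeff M (E * Va * (Wb * Wb)) : ℤ) : ZMod 2) =
        coeff M (PowerSeries.map (Int.castRingHom (ZMod 2)) (Vb * (Wb * Wb))) := by
      rw [map_mul (PowerSeries.map _), ← hmap, ← map_mul (PowerSeries.map _), coeff_map]
      rfl
    rw [coeff_map, (hVb9.mul (hWb9.mul hWb9)).coeff_eq_zero h9, map_zero] at h1
    exact (ZMod.intCast_zmod_eq_zero_iff_dvd _ 2).1 h1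
  obtain ⟨t, ht⟩ := z7
  rw [hdec]
  simp only [map_add, hC, z1, z2, z3, z4, z5, z6, ht]
  exact ⟨coeff M (Va * Wb * (P * Wa)) + t, by ring⟩

/-! ### Divisibility by 3 -/

theorem map_three_cube (F : ℤ⟦X⟧) : PowerSeries.map (Int.castRingHom (ZMod 3)) F ^ 3 =
    PowerSeries.expand 3 three_ne_zero (PowerSeries.map (Int.castRingHom (ZMod 3)) F) := by
  have := MvPowerSeries.map_frobenius_expand (σ := Unit) (R := ZMod 3) 3 three_ne_zero
    (f := PowerSeries.map (Int.castRingHom (ZMod 3)) F)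
  rw [← this, ZMod.frobenius_zmod]
  simp [PowerSeries.expand]

/-- The product of this series with φ(-q²)³ is φ(q). Modulo 3 the cube is a nonzero series in q³, so
it respects residue classes of exponents, and φ(q) has no exponent 2 mod 3. -/
theorem three_dvd_coeff_overcubicSeries (m : ℕ) (hm : m % 3 = 2) :
    ((coeff m overcubicSeries : ℤ) : ZMod 3) = 0 := by
  set f := PowerSeries.map (Int.castRingHom (ZMod 3)) with hf
  have h1 : overcubicSeries * dilate 1 altSquareSeries ^ 3 = squareSeries := by
    linear_combination squareSeries * overcubicSeries_mul -
      overcubicSeries * dilate 1 altSquareSeries * squareSeries_mul_altSquareSeries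
  set D := f (dilate 1 altSquareSeries) ^ 3 with hD
  have h2 : f overcubicSeries * D = f squareSeries := by
    rw [hD, ← map_pow, ← map_mul, h1]
  have hDs : SupportedMod 3 0 D := by
    rw [hD, map_three_cube]
    exact SupportedMod.expand_zero _ _
  have hD0 : D ≠ 0 := by
    refine pow_ne_zero 3 fun h => ?_
    have h' := congrArg f overcubicSeries_mul
    rw [map_mul, map_mul, h, map_one] at h'
    simp at h'
  have h3 : residuePart 3 2 (f squareSeries) = 0 := by
    ext n
    rw [residuePart, coeff_mk, hf, coeff_map, squareSeries, coeff_mk, map_zero]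
    split_ifs with h h' h''
    · omega
    · exact absurd h (isSquare_mod_three h'')
    · simp
    · rfl
  rw [← h2, eq_sum_residuePart_three (f overcubicSeries), add_mul, add_mul, residuePart_add,
    residuePart_add,
    residuePart_of_not ((supportedMod_residuePart _).mul hDs) (by norm_num),
    residuePart_of_not ((supportedMod_residuePart _).mul hDs) (by norm_num),
    residuePart_of_supported ((supportedMod_residuePart _).mul hDs) (by norm_num),
    zero_add, zero_add] at h3
  have h4 := congrArg (coeff m) ((mul_eq_zero.1 h3).resolve_right hD0)
  rw [residuePart, coeff_mk, if_pos hm, hf, coeff_map, map_zero] at h4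
  exact h4

/-- Cubing modulo 3 is q ↦ q³, so the count at 3m reduces to the number of overcubic partitions of
m. -/
theorem three_dvd_overlineBt (m : ℕ) (hm : m % 3 = 2) : 3 ∣ overlineBt (3 * m) := by
  have h1 : ((overlineBt (3 * m) : ℤ) : ZMod 3) =
      coeff (3 * m) (PowerSeries.map (Int.castRingHom (ZMod 3)) overcubicSeries ^ 3) := by
    rw [overlineBt_eq_coeff, ← map_pow, coeff_map]
    rfl
  rw [map_three_cube, coeff_expand_mul, coeff_map] at h1
  have h2 := three_dvd_coeff_overcubicSeries m hm
  rw [← eq_intCast (Int.castRingHom (ZMod 3))] at h2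
  rw [h2] at h1
  exact_mod_cast (ZMod.intCast_zmod_eq_zero_iff_dvd _ 3).1 h1

/-! ### Identities in rings where 128 = 0 -/

section CharacteristicIdentities

variable {R : Type*} [CommRing R]

theorem exists_one_add_two_mul_pow (e : R) (k : ℕ) :
    ∃ y, (1 + 2 * e) ^ 2 ^ k = 1 + 2 ^ (k + 1) * y := by
  induction k with
  | zero => exact ⟨e, by ring⟩
  | succ k ih =>
    obtain ⟨y, hy⟩ := ih
    refine ⟨y + 2 ^ k * y ^ 2, ?_⟩
    rw [pow_succ, pow_mul, hy]
    ring

theorem one_add_two_mul_pow_sixtyFour (h : (128 : R) = 0) (e : R) : (1 + 2 * e) ^ 64 = 1 := by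
  obtain ⟨y, hy⟩ := exists_one_add_two_mul_pow e 6
  norm_num at hy
  rw [hy, h]
  ring

theorem thirtyTwo_mul_pow (h : (128 : R) = 0) {p : R} (hp : ∃ e, p = 1 + 2 * e) (k : ℕ) :
    32 * p ^ (2 * k) = 32 := by
  obtain ⟨e, rfl⟩ := hp
  induction k with
  | zero => simp
  | succ k ih =>
    rw [mul_add, pow_add, ← mul_assoc, ih]
    linear_combination (e + e ^ 2) * h

theorem sixteen_mul_pow_eight (h : (128 : R) = 0) {p : R} (hp : ∃ e, p = 1 + 2 * e) :
    16 * p ^ 8 = 16 := by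
  obtain ⟨e, rfl⟩ := hp
  obtain ⟨y, hy⟩ := exists_one_add_two_mul_pow e 3
  norm_num at hy
  rw [hy]
  linear_combination 2 * y * h

/-- Meant for p = φ(q), a = φ(q⁴), b = φ(q²), v = V(q) and their dilations. It replaces a high power
of p by a series in q² times an expression linear in p and v. The case j = 1 is a direct expansion;
it iterates because 16 p⁸ = 16 = 16 b⁸. -/
theorem pow_eight_mul_add_one (h : (128 : R) = 0) {a b p v : R} (hp : p = a + 2 * v)
    (hb : b ^ 2 = a ^ 2 + 4 * v ^ 2) (hp1 : ∃ e, p = 1 + 2 * e) (hb1 : ∃ e, b = 1 + 2 * e)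
    (j : ℕ) : p ^ (8 * j + 1) = b ^ (8 * j) * (p + 16 * j * v) := by
  have h9 : p ^ 9 = b ^ 8 * (p + 16 * v) := by
    have : b ^ 8 = (a ^ 2 + 4 * v ^ 2) ^ 4 := by rw [← hb]; ring
    rw [this, hp]
    linear_combination (a ^ 7 * v ^ 2 + 3 * a ^ 6 * v ^ 3 + 15 * a ^ 5 * v ^ 4 +
      18 * a ^ 4 * v ^ 5 + 40 * a ^ 3 * v ^ 6 + 16 * a * v ^ 8 - 32 * v ^ 9) * h
  have hp8 := sixteen_mul_pow_eight h hp1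
  have hb8 := sixteen_mul_pow_eight h hb1
  clear hp hb hp1 hb1
  induction j with
  | zero => simp
  | succ j ih =>
    have e1 : p ^ (8 * (j + 1) + 1) = p ^ (8 * j + 1) * p ^ 8 := by ring
    have e2 : b ^ (8 * (j + 1)) = b ^ (8 * j) * b ^ 8 := by ring
    rw [e1, e2, ih]
    push_cast
    linear_combination b ^ (8 * j) * h9 + b ^ (8 * j) * j * v * (hp8 - hb8)

/-- This is `pow_eight_mul_add_one` divided by p, which is invertible since p^64 = 1; the factor 2
makes 32 p² = 32 available. Taking v negative gives the version for φ(-q). -/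
theorem two_mul_pow_eight_mul (h : (128 : R) = 0) {a b p v : R} (hp : p = a + 2 * v)
    (hb : b ^ 2 = a ^ 2 + 4 * v ^ 2) (hp1 : ∃ e, p = 1 + 2 * e) (hb1 : ∃ e, b = 1 + 2 * e)
    (j : ℕ) : 2 * p ^ (8 * j) = 2 * b ^ (8 * j) * (1 + 16 * j * v * p) := by
  have h1 := pow_eight_mul_add_one h hp hb hp1 hb1 j
  have h2 := thirtyTwo_mul_pow h hp1 1
  have h64 : p ^ 64 = 1 := by
    obtain ⟨e, rfl⟩ := hp1
    exact one_add_two_mul_pow_sixtyFour h e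
  have h3 : (2 * p ^ (8 * j) - 2 * b ^ (8 * j) * (1 + 16 * j * v * p)) * p ^ 2 = 0 := by
    linear_combination 2 * p * h1 - b ^ (8 * j) * j * v * p * h2
  have h4 : (2 * p ^ (8 * j) - 2 * b ^ (8 * j) * (1 + 16 * j * v * p)) * p ^ 64 = 0 := by
    linear_combination p ^ 62 * h3
  rw [h64, mul_one] at h4
  exact sub_eq_zero.1 h4

/-- With p = φ(q) and v = V(q), p - 4v is φ(-q). This is what simplifies the series after the first
extraction of even exponents. -/
theorem mul_sub_four_mul_pow (h : (128 : R) = 0) (p v : R) :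
    (p ^ 2 + 8 * p * v - 16 * v ^ 2) * (p - 4 * v) ^ 27 = p ^ 28 * (p + 28 * v) := by
  have h9 : (p - 4 * v) ^ 9 = p ^ 9 + 92 * p ^ 8 * v + 64 * p ^ 7 * v ^ 2 := by
    linear_combination (-p ^ 8 * v + 4 * p ^ 7 * v ^ 2 - 42 * p ^ 6 * v ^ 3 +
      252 * p ^ 5 * v ^ 4 - 1008 * p ^ 4 * v ^ 5 + 2688 * p ^ 3 * v ^ 6 - 4608 * p ^ 2 * v ^ 7 +
      4608 * p * v ^ 8 - 2048 * v ^ 9) * h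
  have h27 : (p - 4 * v) ^ 27 =
      p ^ 24 * (p ^ 3 + 20 * p ^ 2 * v + 112 * p * v ^ 2 + 64 * v ^ 3) := by
    have : (p - 4 * v) ^ 27 = ((p - 4 * v) ^ 9) ^ 3 := by rw [← pow_mul]
    rw [this, h9]
    linear_combination (2 * p ^ 26 * v + 199 * p ^ 25 * v ^ 2 + 6359 * p ^ 24 * v ^ 3 +
      12792 * p ^ 23 * v ^ 4 + 8832 * p ^ 22 * v ^ 5 + 2048 * p ^ 21 * v ^ 6) * h
  rw [h27]
  linear_combination p ^ 24 * (2 * p ^ 3 * v ^ 2 + 5 * p ^ 2 * v ^ 3 - 10 * p * v ^ 4 -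
    8 * v ^ 5) * h

end CharacteristicIdentities

/-! ### Theta series modulo 128 -/

theorem ofNat_128_eq_zero : (128 : (ZMod 128)⟦X⟧) = 0 := by
  have h : (128 : (ZMod 128)⟦X⟧) = C (128 : ZMod 128) :=
    (map_ofNat (C : ZMod 128 →+* (ZMod 128)⟦X⟧) 128).symm
  rw [h, show (128 : ZMod 128) = 0 from rfl, map_zero]

/-- The reduction of `φ(q ^ (2 ^ i))` modulo 128. -/
noncomputable def squareMod (i : ℕ) : (ZMod 128)⟦X⟧ :=
  PowerSeries.map (Int.castRingHom (ZMod 128)) (dilate i squareSeries)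

/-- The reduction of `oddSquareSeries` at `q ^ (2 ^ i)` modulo 128. -/
noncomputable def oddMod (i : ℕ) : (ZMod 128)⟦X⟧ :=
  PowerSeries.map (Int.castRingHom (ZMod 128)) (dilate i oddSquareSeries)

/-- The reduction of `φ(-q ^ (2 ^ i))` modulo 128. -/
noncomputable def altMod (i : ℕ) : (ZMod 128)⟦X⟧ :=
  PowerSeries.map (Int.castRingHom (ZMod 128)) (dilate i altSquareSeries)

theorem squareMod_eq (i : ℕ) : squareMod i = squareMod (i + 2) + 2 * oddMod i := by
  have h := congrArg (fun F => PowerSeries.map (Int.castRingHom (ZMod 128)) (dilate i F))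
    squareSeries_eq
  simp only [map_add, map_mul, map_ofNat, dilate_dilate] at h
  exact h

theorem altMod_eq (i : ℕ) : altMod i = squareMod (i + 2) - 2 * oddMod i := by
  rw [altMod, altSquareSeries]
  simp only [map_sub, map_mul, map_ofNat, dilate_dilate]
  rfl

theorem squareMod_sq (i : ℕ) :
    squareMod (i + 1) ^ 2 = squareMod (i + 2) ^ 2 + 4 * oddMod i ^ 2 := by
  have h := congrArg (fun F => PowerSeries.map (Int.castRingHom (ZMod 128)) (dilate i F))
    dilate_one_squareSeries_sq
  simp only [map_add, map_mul, map_pow, map_ofNat, dilate_dilate] at h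
  exact h

theorem oddMod_sq (i : ℕ) : oddMod i ^ 2 = squareMod (i + 3) * oddMod (i + 1) := by
  have h := congrArg (fun F => PowerSeries.map (Int.castRingHom (ZMod 128)) (dilate i F))
    oddSquareSeries_sq
  simp only [map_mul, map_pow, dilate_dilate] at h
  exact h

theorem squareMod_mul_altMod (i : ℕ) : squareMod i * altMod i = altMod (i + 1) ^ 2 := by
  have h := congrArg (fun F => PowerSeries.map (Int.castRingHom (ZMod 128)) (dilate i F))
    squareSeries_mul_altSquareSeries
  simp only [map_mul, map_pow, dilate_dilate] at h
  exact h

theorem exists_squareSeries : ∃ E, squareSeries = 1 + 2 * E := by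
  refine ⟨PowerSeries.mk fun n => if n = 0 then 0 else if IsSquare n then 1 else 0, ?_⟩
  have h2 : (2 : ℤ⟦X⟧) = C (2 : ℤ) := by simp
  ext n
  rw [h2, map_add, coeff_C_mul, coeff_one, squareSeries, coeff_mk, coeff_mk]
  split_ifs <;> simp

theorem exists_squareMod (i : ℕ) : ∃ e, squareMod i = 1 + 2 * e := by
  obtain ⟨E, hE⟩ := exists_squareSeries
  exact ⟨PowerSeries.map (Int.castRingHom (ZMod 128)) (dilate i E), by
    rw [squareMod, hE]; simp only [map_add, map_mul, map_one, map_ofNat]⟩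

theorem exists_altMod (i : ℕ) : ∃ e, altMod i = 1 + 2 * e := by
  obtain ⟨e, he⟩ := exists_squareMod (i + 2)
  exact ⟨e - oddMod i, by rw [altMod_eq, he]; ring⟩

theorem squareMod_pow_sixtyFour (i : ℕ) : squareMod i ^ 64 = 1 := by
  obtain ⟨e, he⟩ := exists_squareMod i
  rw [he, one_add_two_mul_pow_sixtyFour ofNat_128_eq_zero]

theorem altMod_pow_sixtyFour (i : ℕ) : altMod i ^ 64 = 1 := by
  obtain ⟨e, he⟩ := exists_altMod i
  rw [he, one_add_two_mul_pow_sixtyFour ofNat_128_eq_zero]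

theorem supportedMod_squareMod (i k : ℕ) (h : k ∣ 2 ^ i) : SupportedMod k 0 (squareMod i) :=
  ((supportedMod_dilate i _).map _).of_dvd h

theorem supportedMod_altMod (i k : ℕ) (h : k ∣ 2 ^ i) : SupportedMod k 0 (altMod i) :=
  ((supportedMod_dilate i _).map _).of_dvd h

theorem supportedMod_oddMod (i k : ℕ) (h : k ∣ 2 ^ i * 8) : SupportedMod k (2 ^ i) (oddMod i) := by
  have := (supportedMod_oddSquareSeries.expand (d := 2 ^ i) (by positivity)).map
    (Int.castRingHom (ZMod 128))
  rw [mul_one] at this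
  exact this.of_dvd h

theorem expand_squareMod (i : ℕ) :
    PowerSeries.expand 2 two_ne_zero (squareMod i) = squareMod (i + 1) := by
  rw [squareMod, squareMod, ← map_expand, add_comm, ← dilate_dilate]
  rfl

theorem expand_altMod (i : ℕ) :
    PowerSeries.expand 2 two_ne_zero (altMod i) = altMod (i + 1) := by
  rw [altMod, altMod, ← map_expand, add_comm, ← dilate_dilate]
  rfl

theorem expand_oddMod (i : ℕ) :
    PowerSeries.expand 2 two_ne_zero (oddMod i) = oddMod (i + 1) := by
  rw [oddMod, oddMod, ← map_expand, add_comm, ← dilate_dilate]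
  rfl

theorem coeff_two_mul_of_eq {G F O : (ZMod 128)⟦X⟧}
    (h : G = PowerSeries.expand 2 two_ne_zero F + O) (hO : SupportedMod 2 1 O) (n : ℕ) :
    coeff (2 * n) G = coeff n F := by
  rw [h, map_add, coeff_expand_mul, hO.coeff_eq_zero (by rw [Nat.ModEq]; omega), add_zero]

/-! ### Vanishing at the target exponents -/

/-- The exponents that occur in the theorem. -/
def IsTarget (n : ℕ) : Prop := n % 8 = 5 ∧ n % 3 = 0 ∧ n % 9 ≠ 0

/-- Applying `oddMod_sq` twice identifies the product with V(q)³ V(q²), to which `four_dvd_coeff`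
applies. -/
theorem coeff_thirtyTwo_mul {n : ℕ} (hn : IsTarget n) (z : ℤ) :
    coeff n ((32 * z : (ZMod 128)⟦X⟧) *
      (oddMod 0 * squareMod 3 * (squareMod 4 * oddMod 2))) = 0 := by
  have h1 : oddMod 0 * squareMod 3 * (squareMod 4 * oddMod 2) =
      PowerSeries.map (Int.castRingHom (ZMod 128))
        (oddSquareSeries ^ 3 * dilate 1 oddSquareSeries) := by
    have e0 := oddMod_sq 0
    have e1 := oddMod_sq 1
    have e2 : PowerSeries.map (Int.castRingHom (ZMod 128)) oddSquareSeries = oddMod 0 := by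
      rw [oddMod, dilate_zero]
    have e3 : PowerSeries.map (Int.castRingHom (ZMod 128)) (dilate 1 oddSquareSeries) =
      oddMod 1 := rfl
    rw [map_mul, map_pow, e2, e3]
    norm_num at e0 e1
    linear_combination (-oddMod 0 * oddMod 1) * e0 - oddMod 0 * squareMod 3 * e1
  obtain ⟨t, ht⟩ := four_dvd_coeff n hn.2.1 hn.2.2
  have hC : (32 * z : (ZMod 128)⟦X⟧) = C (32 * z : ZMod 128) := by
    rw [map_mul, map_ofNat, map_intCast]
  rw [h1, hC, coeff_C_mul, coeff_map, ht]
  have : (128 : ZMod 128) = 0 := rfl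
  simp only [eq_intCast]
  push_cast
  linear_combination z * t * this

/-- The first two summands have exponents 1 mod 8 and 1 + 2 = 3 mod 4, so neither reaches an
exponent 5 mod 8. -/
theorem coeff_eq_zero_of_decomposition {n : ℕ} (hn : IsTarget n) {G S T : (ZMod 128)⟦X⟧} (z : ℤ)
    (h : G = oddMod 0 * S + oddMod 0 * (oddMod 1 * T) +
      (32 * z) * (oddMod 0 * squareMod 3 * (squareMod 4 * oddMod 2)))
    (hS : SupportedMod 8 0 S) (hT : SupportedMod 4 0 T) : coeff n G = 0 := by
  have h0 := supportedMod_oddMod 0 8 (by norm_num)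
  have h1 := supportedMod_oddMod 1 4 (by norm_num)
  have hn8 := hn.1
  rw [h, map_add, map_add, coeff_thirtyTwo_mul hn,
    (h0.mul hS).coeff_eq_zero (by rw [Nat.ModEq]; omega),
    ((h0.of_dvd (by norm_num : 4 ∣ 8)).mul (h1.mul hT)).coeff_eq_zero
      (by rw [Nat.ModEq]; omega)]
  simp

/-- Both high powers are pushed down to powers of φ(q⁴) and then of φ(q⁸). The multiples of V(q²) go
into `T`; the correction 16(j + c) V(q⁴) φ(q⁴), doubled, yields the term with 32. -/
theorem coeff_odd_mul_eq_zero {n : ℕ} (hn : IsTarget n) (j c : ℕ) :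
    coeff n (2 * oddMod 0 * squareMod 1 ^ (8 * j + 1) * altMod 1 ^ (8 * c)) = 0 := by
  have h128 := ofNat_128_eq_zero
  have hA := pow_eight_mul_add_one h128 (squareMod_eq 1) (squareMod_sq 1) (exists_squareMod 1)
    (exists_squareMod 2) j
  have hB := two_mul_pow_eight_mul h128 (a := squareMod 3) (b := squareMod 2) (p := altMod 1)
    (v := -oddMod 1) (by rw [altMod_eq]; ring) (by rw [squareMod_sq 1]; ring) (exists_altMod 1)
    (exists_squareMod 2) c
  have hB2 := two_mul_pow_eight_mul h128 (squareMod_eq 2) (squareMod_sq 2) (exists_squareMod 2)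
    (exists_squareMod 3) (j + c)
  have hM := squareMod_mul_altMod 1
  have hP1 := squareMod_eq 1
  have hP2 := squareMod_eq 2
  have h32 := thirtyTwo_mul_pow h128 (exists_squareMod 3) (4 * (j + c))
  norm_num at hA hB hB2 hM hP1 hP2 h32
  rw [← mul_assoc] at h32
  norm_num at h32
  refine coeff_eq_zero_of_decomposition hn (j + c : ℤ)
    (S := 2 * squareMod 3 ^ (8 * (j + c)) * (1 + 32 * (j + c : ℕ) * oddMod 2 ^ 2) * squareMod 3)
    (T := 2 * squareMod 2 ^ (8 * (j + c)) * (2 + 16 * (j : ℕ) - 16 * (c : ℕ) * altMod 2 ^ 2))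
    ?_ ?_ ?_
  · have e1 : 2 * squareMod 1 ^ (8 * j + 1) * altMod 1 ^ (8 * c) =
        2 * squareMod 2 ^ (8 * (j + c)) *
          (squareMod 1 + 16 * j * oddMod 1 - 16 * c * oddMod 1 * altMod 2 ^ 2) := by
      rw [hA]
      have : squareMod 2 ^ (8 * (j + c)) = squareMod 2 ^ (8 * j) * squareMod 2 ^ (8 * c) := by
        rw [mul_add, pow_add]
      rw [this]
      linear_combination (squareMod 2 ^ (8 * j) * (squareMod 1 + 16 * j * oddMod 1)) * hB -
        (32 * squareMod 2 ^ (8 * j) * squareMod 2 ^ (8 * c) * c * oddMod 1) * hM -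
        (4 * squareMod 2 ^ (8 * j) * squareMod 2 ^ (8 * c) * c * j * oddMod 1 ^ 2 *
          altMod 1) * h128
    push_cast
    linear_combination oddMod 0 * e1 +
      oddMod 0 * 2 * squareMod 2 ^ (8 * (j + c)) * hP1 + oddMod 0 * squareMod 3 * hB2 +
      (oddMod 0 * squareMod 3 * 32 * squareMod 3 ^ (8 * (j + c)) * (j + c) * oddMod 2) * hP2 +
      oddMod 0 * squareMod 3 * (j + c) * oddMod 2 * squareMod 4 * h32
  · have s3 := supportedMod_squareMod 3 8 (by norm_num)
    have v2 : SupportedMod 8 0 (oddMod 2 ^ 2) := by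
      rw [sq]
      have := supportedMod_oddMod 2 8 (by norm_num)
      exact (this.mul this).of_modEq rfl
    exact (((SupportedMod.ofNat 2).zero_class_mul (s3.pow _)).zero_class_mul
      (SupportedMod.one.add (((SupportedMod.ofNat 32).zero_class_mul
        (SupportedMod.natCast _)).zero_class_mul v2))).zero_class_mul s3
  · have s2 := supportedMod_squareMod 2 4 (by norm_num)
    have m2 := supportedMod_altMod 2 4 (by norm_num)
    exact ((SupportedMod.ofNat 2).zero_class_mul (s2.pow _)).zero_class_mul
      (((SupportedMod.ofNat 2).add ((SupportedMod.ofNat 16).zero_class_mul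
        (SupportedMod.natCast _))).sub (((SupportedMod.ofNat 16).zero_class_mul
        (SupportedMod.natCast _)).zero_class_mul (m2.pow 2)))

/-- The reduction of `overcubicSeries` modulo 128. -/
noncomputable def overcubicMod : (ZMod 128)⟦X⟧ :=
  PowerSeries.map (Int.castRingHom (ZMod 128)) overcubicSeries

theorem overlineBt_eq_coeff_overcubicMod (n : ℕ) :
    (overlineBt n : ZMod 128) = coeff n (overcubicMod ^ 3) := by
  have h := overlineBt_eq_coeff n
  rw [overcubicMod, ← map_pow, coeff_map, ← h]
  simp

/-- Since φ(-q)⁻¹ = φ(q) φ(-q²)⁻², the cube is φ(q)³ φ(-q²)⁻⁹, and -9 ≡ 55 mod 64. -/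
theorem overcubicMod_pow_three : overcubicMod ^ 3 = squareMod 0 ^ 3 * altMod 1 ^ 55 := by
  have h := congrArg (PowerSeries.map (Int.castRingHom (ZMod 128))) overcubicSeries_mul
  have h0 : PowerSeries.map (Int.castRingHom (ZMod 128)) altSquareSeries = altMod 0 := by
    rw [altMod, dilate_zero]
  have h1 : overcubicMod * (altMod 0 * altMod 1) = 1 := by
    rw [map_mul, map_mul, h0, map_one] at h
    exact h
  have h2 : squareMod 0 * altMod 0 = altMod 1 ^ 2 := squareMod_mul_altMod 0
  have h3 : (overcubicMod * (altMod 0 * altMod 1)) ^ 3 = 1 := by rw [h1, one_pow]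
  have h4 : (squareMod 0 * altMod 0) ^ 3 = altMod 1 ^ 6 := by rw [h2, ← pow_mul]
  have h5 := altMod_pow_sixtyFour 1
  linear_combination squareMod 0 ^ 3 * altMod 1 ^ 55 * h3 -
    overcubicMod ^ 3 * altMod 1 ^ 58 * h4 - overcubicMod ^ 3 * h5

theorem coeff_eq_zero_of_isTarget {n : ℕ} (hn : IsTarget n) :
    coeff n (squareMod 0 ^ 3 * altMod 1 ^ 55) = 0 := by
  have h128 := ofNat_128_eq_zero
  have hP0 := squareMod_eq 0
  have hV0 := oddMod_sq 0
  norm_num at hP0 hV0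
  have hdec : squareMod 0 ^ 3 * altMod 1 ^ 55 =
      (squareMod 2 ^ 3 + 12 * squareMod 2 * oddMod 0 ^ 2) * altMod 1 ^ 55 +
      oddMod 0 * ((6 * squareMod 2 ^ 2 + 8 * oddMod 0 ^ 2) * altMod 1 ^ 55) := by
    rw [hP0]
    ring
  have hev : SupportedMod 2 0
      ((squareMod 2 ^ 3 + 12 * squareMod 2 * oddMod 0 ^ 2) * altMod 1 ^ 55) := by
    rw [hV0]
    have p2 := supportedMod_squareMod 2 2 (by norm_num)
    have p3 := supportedMod_squareMod 3 2 (by norm_num)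
    have v1 := (supportedMod_oddMod 1 2 (by norm_num)).of_modEq (s := 0) rfl
    have m1 := supportedMod_altMod 1 2 (by norm_num)
    exact ((p2.pow 3).add (((SupportedMod.ofNat 12).zero_class_mul p2).zero_class_mul
      (p3.zero_class_mul v1))).zero_class_mul (m1.pow 55)
  rw [hdec, map_add, hev.coeff_eq_zero (by have := hn.1; rw [Nat.ModEq]; omega), zero_add]
  have hP1 := squareMod_eq 1
  have hP2 := squareMod_eq 2
  have hM1 := altMod_eq 1
  have hPM1 := squareMod_mul_altMod 1
  have hPM2 := squareMod_mul_altMod 2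
  have hV1 := oddMod_sq 1
  have hsq := squareMod_sq 1
  have hB := two_mul_pow_eight_mul h128 (a := squareMod 3) (b := squareMod 2) (p := altMod 1)
    (v := -oddMod 1) (by rw [altMod_eq]; ring) (by rw [squareMod_sq 1]; ring) (exists_altMod 1)
    (exists_squareMod 2) 7
  have hB2 := two_mul_pow_eight_mul h128 (squareMod_eq 2) (squareMod_sq 2) (exists_squareMod 2)
    (exists_squareMod 3) 7
  have h2 := altMod_pow_sixtyFour 2
  have h3 := altMod_pow_sixtyFour 3
  have t56 := thirtyTwo_mul_pow h128 (exists_squareMod 3) 28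
  have t60 := thirtyTwo_mul_pow h128 (exists_altMod 3) 30
  have tt := thirtyTwo_mul_pow h128 (exists_squareMod 3) 1
  have tt2 := thirtyTwo_mul_pow h128 (exists_squareMod 3) 2
  norm_num at hP1 hP2 hM1 hPM1 hPM2 hV1 hsq hB hB2 t56 t60 tt tt2
  -- The exponent 55 is raised to a multiple of 8 using φ(-q²)⁻¹ = φ(q²) φ(-q⁴)⁻², and 62 stands for
  -- -2 modulo 64. In `i2`, likewise, 60 stands for -4.
  have i1 : altMod 1 ^ 55 = squareMod 1 * altMod 1 ^ 56 * altMod 2 ^ 62 := by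
    linear_combination (-altMod 1 ^ 55) * h2 - altMod 1 ^ 55 * altMod 2 ^ 62 * hPM1
  have i2 : altMod 2 ^ 62 = squareMod 2 ^ 2 * altMod 3 ^ 60 := by
    have : (squareMod 2 * altMod 2) ^ 2 = altMod 3 ^ 4 := by rw [hPM2, ← pow_mul]
    linear_combination (-altMod 2 ^ 62) * h3 - altMod 2 ^ 62 * altMod 3 ^ 60 * this +
      squareMod 2 ^ 2 * altMod 3 ^ 60 * h2
  -- This separates off a multiple of V(q²), destined for `T`; `i4` treats the remainder, a series
  -- in q⁴, and isolates -32 V(q²)² = -32 φ(q^16) V(q⁴), whence z = -1.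
  have i3 : (6 * squareMod 2 ^ 2 + 8 * oddMod 0 ^ 2) * squareMod 1 * altMod 1 ^ 56 =
      2 * squareMod 2 ^ 56 * squareMod 3 * (3 * squareMod 2 ^ 2 + 8 * oddMod 1 ^ 2) +
      oddMod 1 * (2 * squareMod 2 ^ 56 * ((1 - 32 * oddMod 1 ^ 2) *
        (6 * squareMod 2 ^ 2 + 4 * squareMod 3 ^ 2) + 16 * squareMod 3 *
        (3 * squareMod 2 ^ 2 * squareMod 3 + 8 * squareMod 3 * oddMod 1 ^ 2))) := by
    generalize squareMod 1 = p1 at *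
    generalize squareMod 2 = p2 at *
    generalize squareMod 3 = p3 at *
    generalize altMod 1 = m at *
    generalize oddMod 1 = v at *
    linear_combination 8 * p1 * m ^ 56 * hV0 + (6 * p2 ^ 2 + 8 * p3 * v) * m ^ 56 * hP1 +
      (3 * p2 ^ 2 * p3 + 8 * p3 * v ^ 2 + v * (6 * p2 ^ 2 + 4 * p3 ^ 2)) * hB -
      224 * p2 ^ 56 * v *
        (3 * p2 ^ 2 * p3 + 8 * p3 * v ^ 2 + v * (6 * p2 ^ 2 + 4 * p3 ^ 2)) * hM1 +
      p2 ^ 56 * (-6 * p2 ^ 2 * p3 ^ 2 * v - 7 * p3 ^ 3 * v ^ 2 + 28 * p3 * v ^ 4 +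
        24 * p2 ^ 2 * v ^ 3) * h128
  have i4 : 2 * squareMod 2 ^ 56 * (3 * squareMod 2 ^ 2 + 8 * oddMod 1 ^ 2) * altMod 2 ^ 62 =
      squareMod 3 ^ 56 * altMod 3 ^ 60 * (6 * squareMod 3 ^ 4 + 32 * (oddMod 1 ^ 2) ^ 2 -
        64 * squareMod 3 ^ 4 * oddMod 2 ^ 2) - 32 * oddMod 1 ^ 2 := by
    have f : (64 * squareMod 3 ^ 2 - 96 * squareMod 3 ^ 4) * squareMod 3 ^ 56 * altMod 3 ^ 60 =
        -32 := by
      linear_combination 2 * squareMod 3 ^ 56 * altMod 3 ^ 60 * tt -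
        3 * squareMod 3 ^ 56 * altMod 3 ^ 60 * tt2 - altMod 3 ^ 60 * t56 - t60
    have g : (3 * squareMod 2 ^ 2 + 8 * oddMod 1 ^ 2) * squareMod 2 ^ 2 =
        3 * squareMod 3 ^ 4 + 32 * squareMod 3 ^ 2 * oddMod 1 ^ 2 + 80 * oddMod 1 ^ 4 := by
      rw [hsq]
      ring
    generalize squareMod 2 = p at *
    generalize squareMod 3 = a at *
    generalize squareMod 4 = b at *
    generalize altMod 2 = m2 at *
    generalize altMod 3 = m3 at *
    generalize oddMod 1 = v at *
    generalize oddMod 2 = t at *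
    linear_combination 2 * p ^ 56 * (3 * p ^ 2 + 8 * v ^ 2) * i2 + 2 * p ^ 56 * m3 ^ 60 * g +
      (3 * a ^ 4 + 32 * a ^ 2 * v ^ 2 + 80 * v ^ 4) * m3 ^ 60 * hB2 +
      224 * a ^ 56 * m3 ^ 60 * (3 * a ^ 4 + 32 * a ^ 2 * v ^ 2 + 80 * v ^ 4) * (t * hP2 - hV1) +
      a ^ 56 * m3 ^ 60 * (6 * a ^ 4 * v ^ 2 + 56 * a ^ 2 * v ^ 4 + 140 * v ^ 6 + v ^ 4 +
        11 * a ^ 4 * t ^ 2 + 112 * a ^ 2 * t ^ 2 * v ^ 2 + 280 * t ^ 2 * v ^ 4) * h128 + v ^ 2 * f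
  rw [hV1] at i3 i4
  refine coeff_eq_zero_of_decomposition hn (-1)
    (S := squareMod 3 * (squareMod 3 ^ 56 * altMod 3 ^ 60 * (6 * squareMod 3 ^ 4 +
      32 * (squareMod 4 ^ 2 * oddMod 2 ^ 2) - 64 * squareMod 3 ^ 4 * oddMod 2 ^ 2)))
    (T := 2 * squareMod 2 ^ 56 * ((1 - 32 * (squareMod 4 * oddMod 2)) *
        (6 * squareMod 2 ^ 2 + 4 * squareMod 3 ^ 2) + 16 * squareMod 3 *
        (3 * squareMod 2 ^ 2 * squareMod 3 + 8 * squareMod 3 * (squareMod 4 * oddMod 2))) *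
        altMod 2 ^ 62) ?_ ?_ ?_
  · push_cast
    linear_combination oddMod 0 * (6 * squareMod 2 ^ 2 + 8 * oddMod 0 ^ 2) * i1 +
      oddMod 0 * altMod 2 ^ 62 * i3 + oddMod 0 * squareMod 3 * i4
  · have p3 := supportedMod_squareMod 3 8 (by norm_num)
    have p4 := supportedMod_squareMod 4 8 (by norm_num)
    have m3 := supportedMod_altMod 3 8 (by norm_num)
    have v2 : SupportedMod 8 0 (oddMod 2 ^ 2) := by
      rw [sq]
      have := supportedMod_oddMod 2 8 (by norm_num)
      exact (this.mul this).of_modEq rfl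
    exact p3.zero_class_mul (((p3.pow _).zero_class_mul (m3.pow _)).zero_class_mul
      ((((SupportedMod.ofNat 6).zero_class_mul (p3.pow _)).add
      ((SupportedMod.ofNat 32).zero_class_mul ((p4.pow _).zero_class_mul v2))).sub
      (((SupportedMod.ofNat 64).zero_class_mul (p3.pow _)).zero_class_mul v2)))
  · have p2 := supportedMod_squareMod 2 4 (by norm_num)
    have p3 := supportedMod_squareMod 3 4 (by norm_num)
    have w := (supportedMod_squareMod 4 4 (by norm_num)).zero_class_mul
      ((supportedMod_oddMod 2 4 (by norm_num)).of_modEq (s := 0) rfl)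
    have m2 := supportedMod_altMod 2 4 (by norm_num)
    exact (((SupportedMod.ofNat 2).zero_class_mul (p2.pow _)).zero_class_mul
      (((SupportedMod.one.sub ((SupportedMod.ofNat 32).zero_class_mul w)).zero_class_mul
      (((SupportedMod.ofNat 6).zero_class_mul (p2.pow _)).add
      ((SupportedMod.ofNat 4).zero_class_mul (p3.pow _)))).add
      (((SupportedMod.ofNat 16).zero_class_mul p3).zero_class_mul
      ((((SupportedMod.ofNat 3).zero_class_mul (p2.pow _)).zero_class_mul p3).add
      (((SupportedMod.ofNat 8).zero_class_mul p3).zero_class_mul w))))).zero_class_mul (m2.pow _)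

/-! ### Repeated extraction of even exponents -/

/-- The even part of the generating series, with `q ^ 2` replaced by `q`. -/
theorem coeff_two_mul_overcubicMod (n : ℕ) :
    coeff (2 * n) (overcubicMod ^ 3) =
      coeff n (squareMod 1 * altMod 1 ^ 56 * (squareMod 2 + 30 * oddMod 0)) := by
  have h128 := ofNat_128_eq_zero
  -- The right side is the even part of φ(q)³ φ(-q²)^55 after q² ↦ q. The 30 is 28 from
  -- `mul_sub_four_mul_pow` plus 2 from φ(q) = φ(q⁴) + 2V(q).
  have hG : squareMod 1 * altMod 1 ^ 56 * (squareMod 2 + 30 * oddMod 0) =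
      (squareMod 1 ^ 3 + 12 * squareMod 1 * (squareMod 2 * oddMod 0)) * altMod 0 ^ 55 := by
    have hP := squareMod_eq 0
    have hM := altMod_eq 0
    have hPM := squareMod_mul_altMod 0
    have hsq := squareMod_sq 0
    norm_num at hP hM hPM hsq
    have h := mul_sub_four_mul_pow h128 (squareMod 0) (oddMod 0)
    have e1 : squareMod 0 - 4 * oddMod 0 = altMod 0 := by linear_combination hP - hM
    have e2 : squareMod 0 + 28 * oddMod 0 = squareMod 2 + 30 * oddMod 0 := by
      linear_combination hP
    have e3 : squareMod 0 ^ 2 + 8 * squareMod 0 * oddMod 0 - 16 * oddMod 0 ^ 2 =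
        squareMod 1 ^ 2 + 12 * (squareMod 2 * oddMod 0) := by
      rw [hsq, hP]
      ring
    have e4 : altMod 1 ^ 56 = squareMod 0 ^ 28 * altMod 0 ^ 28 := by
      rw [← mul_pow, hPM, ← pow_mul]
    rw [e1, e2, e3] at h
    rw [e4]
    linear_combination (-squareMod 1 * altMod 0 ^ 28) * h
  rw [overcubicMod_pow_three, hG]
  have hP := squareMod_eq 0
  have hV := oddMod_sq 0
  norm_num at hP hV
  refine coeff_two_mul_of_eq
    (O := oddMod 0 * ((6 * squareMod 2 ^ 2 + 8 * (squareMod 3 * oddMod 1)) * altMod 1 ^ 55)) ?_ ?_ n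
  · simp only [map_mul, map_add, map_pow, map_ofNat, expand_squareMod, expand_altMod,
      expand_oddMod]
    norm_num
    rw [hP]
    linear_combination (12 * squareMod 2 + 8 * oddMod 0) * altMod 1 ^ 55 * hV
  · have v0 := supportedMod_oddMod 0 2 (by norm_num)
    have p2 := supportedMod_squareMod 2 2 (by norm_num)
    have p3 := supportedMod_squareMod 3 2 (by norm_num)
    have v1 := (supportedMod_oddMod 1 2 (by norm_num)).of_modEq (s := 0) rfl
    have m1 := supportedMod_altMod 1 2 (by norm_num)
    exact v0.mul_zero_class (((((SupportedMod.ofNat 6).zero_class_mul (p2.pow 2)).add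
      ((SupportedMod.ofNat 8).zero_class_mul (p3.zero_class_mul v1)))).zero_class_mul (m1.pow _))

/-- φ(-q) = φ(-q²)² φ(q)⁻¹, with the exponent -8c written as 56c modulo 64. -/
theorem altMod_pow_eq (c : ℕ) :
    altMod 0 ^ (8 * c) = squareMod 0 ^ (56 * c) * altMod 1 ^ (16 * c) := by
  have h : squareMod 0 * altMod 0 = altMod 1 ^ 2 := squareMod_mul_altMod 0
  have h1 : altMod 1 ^ (16 * c) = squareMod 0 ^ (8 * c) * altMod 0 ^ (8 * c) := by
    rw [← mul_pow, h, ← pow_mul]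
    ring_nf
  have h2 : squareMod 0 ^ (56 * c) * squareMod 0 ^ (8 * c) = 1 := by
    rw [← pow_add, show 56 * c + 8 * c = 64 * c by ring, pow_mul, squareMod_pow_sixtyFour, one_pow]
  rw [h1, ← mul_assoc, h2, one_mul]

theorem supportedMod_two_odd (F : (ZMod 128)⟦X⟧) (hF : SupportedMod 2 0 F) :
    SupportedMod 2 1 (oddMod 0 * F) :=
  (supportedMod_oddMod 0 2 (by norm_num)).mul_zero_class hF

/-- The even part of φ(q)^(8j+1) is φ(q²)^(8j) φ(q⁴), and `altMod_pow_eq` restores the shape after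
q² ↦ q. So the family is closed under extraction. -/
theorem coeff_two_mul_step (j c n : ℕ) :
    coeff (2 * n) (squareMod 1 * squareMod 0 ^ (8 * j + 1) * altMod 1 ^ (8 * c)) =
      coeff n (squareMod 1 * squareMod 0 ^ (8 * (j + 7 * c) + 1) * altMod 1 ^ (8 * (2 * c))) := by
  have hA := pow_eight_mul_add_one ofNat_128_eq_zero (squareMod_eq 0) (squareMod_sq 0)
    (exists_squareMod 0) (exists_squareMod 1) j
  have hP := squareMod_eq 0
  have e : squareMod 1 * squareMod 0 ^ (8 * (j + 7 * c) + 1) * altMod 1 ^ (8 * (2 * c)) =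
      squareMod 1 * squareMod 0 ^ (8 * j + 1) * altMod 0 ^ (8 * c) := by
    rw [altMod_pow_eq]
    ring
  norm_num at hA hP
  rw [e]
  refine coeff_two_mul_of_eq (O := oddMod 0 * ((2 + 16 * (j : ℕ)) *
    squareMod 1 ^ (8 * j + 1) * altMod 1 ^ (8 * c))) ?_ ?_ n
  · simp only [map_mul, map_pow, expand_squareMod, expand_altMod]
    norm_num
    rw [hA]
    linear_combination squareMod 1 * squareMod 1 ^ (8 * j) * altMod 1 ^ (8 * c) * hP
  · have p1 := supportedMod_squareMod 1 2 (by norm_num)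
    have m1 := supportedMod_altMod 1 2 (by norm_num)
    exact supportedMod_two_odd _ ((((SupportedMod.ofNat 2).add ((SupportedMod.ofNat 16).zero_class_mul
      (SupportedMod.natCast j))).zero_class_mul (p1.pow _)).zero_class_mul (m1.pow _))

theorem exists_coeff_eq (α : ℕ) : ∃ j c, ∀ n, coeff (2 ^ (α + 2) * n) (overcubicMod ^ 3) =
    coeff n (squareMod 1 * squareMod 0 ^ (8 * j + 1) * altMod 1 ^ (8 * c)) := by
  induction α with
  | zero =>
    -- `altMod_pow_eq` with c = 7 gives the exponents 56 · 7 = 8 · 49 and 16 · 7 = 8 · 14.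
    refine ⟨49, 14, fun n => ?_⟩
    rw [show 2 ^ (0 + 2) * n = 2 * (2 * n) by ring, coeff_two_mul_overcubicMod]
    have e : squareMod 1 * squareMod 0 ^ (8 * 49 + 1) * altMod 1 ^ (8 * 14) =
        squareMod 0 * altMod 0 ^ (8 * 7) * squareMod 1 := by
      rw [altMod_pow_eq]
      ring
    rw [e]
    refine coeff_two_mul_of_eq (O := oddMod 0 * (30 * squareMod 1 * altMod 1 ^ 56)) ?_ ?_ n
    · simp only [map_mul, map_pow, expand_squareMod, expand_altMod]
      norm_num
      ring
    · have p1 := supportedMod_squareMod 1 2 (by norm_num)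
      have m1 := supportedMod_altMod 1 2 (by norm_num)
      exact supportedMod_two_odd _ (((SupportedMod.ofNat 30).zero_class_mul p1).zero_class_mul
        (m1.pow _))
  | succ α ih =>
    obtain ⟨j, c, h⟩ := ih
    refine ⟨j + 7 * c, 2 * c, fun n => ?_⟩
    rw [← coeff_two_mul_step, ← h, show 2 ^ (α + 1 + 2) * n = 2 ^ (α + 2) * (2 * n) by ring]

theorem coeff_two_mul_eq_zero {n : ℕ} (hn : IsTarget n) :
    coeff (2 * n) (overcubicMod ^ 3) = 0 := by
  have p1 := supportedMod_squareMod 1 2 (by norm_num)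
  have p2 := supportedMod_squareMod 2 2 (by norm_num)
  have m1 := supportedMod_altMod 1 2 (by norm_num)
  have e : squareMod 1 * altMod 1 ^ 56 * (squareMod 2 + 30 * oddMod 0) =
      squareMod 1 * altMod 1 ^ 56 * squareMod 2 +
      C (15 : ZMod 128) * (2 * oddMod 0 * squareMod 1 ^ (8 * 0 + 1) * altMod 1 ^ (8 * 7)) := by
    rw [map_ofNat]
    ring
  rw [coeff_two_mul_overcubicMod, e, map_add, coeff_C_mul, coeff_odd_mul_eq_zero hn 0 7,
    ((p1.zero_class_mul (m1.pow 56)).zero_class_mul p2).coeff_eq_zero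
      (by have := hn.1; rw [Nat.ModEq]; omega)]
  simp

/-- Targets are odd, and the odd part of the series is a scalar multiple of the one in
`coeff_odd_mul_eq_zero`. -/
theorem coeff_stable_eq_zero {n : ℕ} (hn : IsTarget n) (j c : ℕ) :
    coeff n (squareMod 1 * squareMod 0 ^ (8 * j + 1) * altMod 1 ^ (8 * c)) = 0 := by
  have hA := pow_eight_mul_add_one ofNat_128_eq_zero (squareMod_eq 0) (squareMod_sq 0)
    (exists_squareMod 0) (exists_squareMod 1) j
  have hP := squareMod_eq 0
  norm_num at hA hP
  have p1 := supportedMod_squareMod 1 2 (by norm_num)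
  have p2 := supportedMod_squareMod 2 2 (by norm_num)
  have m1 := supportedMod_altMod 1 2 (by norm_num)
  have e : squareMod 1 * squareMod 0 ^ (8 * j + 1) * altMod 1 ^ (8 * c) =
      squareMod 1 * squareMod 1 ^ (8 * j) * squareMod 2 * altMod 1 ^ (8 * c) +
      C (1 + 8 * j : ZMod 128) *
        (2 * oddMod 0 * squareMod 1 ^ (8 * j + 1) * altMod 1 ^ (8 * c)) := by
    rw [map_add, map_mul, map_one, map_ofNat, map_natCast, hA]
    linear_combination squareMod 1 * squareMod 1 ^ (8 * j) * altMod 1 ^ (8 * c) * hP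
  rw [e, map_add, coeff_C_mul, coeff_odd_mul_eq_zero hn j c,
    (((p1.zero_class_mul (p1.pow (8 * j))).zero_class_mul p2).zero_class_mul
      (m1.pow (8 * c))).coeff_eq_zero (by have := hn.1; rw [Nat.ModEq]; omega)]
  simp

theorem overlineBt_modEq_zero {n : ℕ} (hn : IsTarget n) (α : ℕ) :
    overlineBt (2 ^ α * n) ≡ 0 [MOD 128] := by
  rw [Nat.modEq_zero_iff_dvd, ← ZMod.natCast_eq_zero_iff, overlineBt_eq_coeff_overcubicMod]
  match α with
  | 0 => rw [pow_zero, one_mul, overcubicMod_pow_three, coeff_eq_zero_of_isTarget hn]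
  | 1 => rw [pow_one, coeff_two_mul_eq_zero hn]
  | α + 2 =>
    obtain ⟨j, c, h⟩ := exists_coeff_eq α
    rw [h, coeff_stable_eq_zero hn]

/-! ### The three congruences -/

theorem mainTheorem2 :
    (∀ n : ℕ, overlineBt (144 * n + 42) ≡ 0 [MOD 384]) ∧
    (∀ n α : ℕ, overlineBt (2 ^ α * (72 * n + 21)) ≡ 0 [MOD 128]) ∧
    (∀ n α : ℕ, overlineBt (2 ^ α * (72 * n + 69)) ≡ 0 [MOD 128]) := by
  -- The residues 21 and 69 are the only ones modulo 72 that are 5 mod 8 and 3 or 6 mod 9.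
  have h21 : ∀ n, IsTarget (72 * n + 21) := fun n => ⟨by omega, by omega, by omega⟩
  have h69 : ∀ n, IsTarget (72 * n + 69) := fun n => ⟨by omega, by omega, by omega⟩
  refine ⟨fun n => ?_, fun n α => overlineBt_modEq_zero (h21 n) α,
    fun n α => overlineBt_modEq_zero (h69 n) α⟩
  have h1 := overlineBt_modEq_zero (h21 n) 1
  -- 144n + 42 is both 2(72n + 21) and 3(48n + 14), with 48n + 14 ≡ 2 mod 3, and 384 = 3 · 128.
  have h2 := three_dvd_overlineBt (48 * n + 14) (by omega)
  rw [Nat.modEq_zero_iff_dvd, show 2 ^ 1 * (72 * n + 21) = 144 * n + 42 by ring] at h1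
  rw [show 3 * (48 * n + 14) = 144 * n + 42 by ring] at h2
  rw [Nat.modEq_zero_iff_dvd]
  exact Nat.Coprime.mul_dvd_of_dvd_of_dvd (by norm_num : Nat.Coprime 3 128) h2 h1
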